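/- Let $G=(V,E)$ be a finite simple graph with $n$ vertices and $m$ edges, and let $p:S\to[\ell]$, $S\subseteq V$, be a partial coloring (precoloring). With respect to a coloring $c:V\to[\ell]$, a vertex is \emph{happy} if all its neighbors have the same color as the vertex itself, and an edge is \emph{happy} if both its end points have the same color. Given $(G,p,\ell,k)$ with $k\ge 1$, Max Happy Vertices (respectively Max Happy Edges) asks whether some coloring $c:V\to[\ell]$ extending $p$ has at least $k$ happy vertices (respectively edges). A \emph{clique modulator} of $G$ is a set $X\subseteq V$ such that $G\setminus X$ is a clique, and the \emph{distance to clique} of $G$ is the smallest size of a clique modulator. Algorithms are programs of a random access machine with addition and truncated subtraction at unit cost; the input consists of $n$, $\ell$, $k$, the adjacency matrix of $G$ and the precoloring, and neither a clique modulator nor its size is part of it. \textbf{Theorem.} (1) Max Happy Vertices and Max Happy Edges are both fixed-parameter tractable when parameterized by the distance to clique $\kappa$ of the input graph: each is decided by an algorithm in time $f(\kappa)\cdot|I|^{c}$, where $f$ is a computable function, $c$ is a constant and $|I|$ is the size of the input in bits (numbers are written in binary). (2) There is an algorithm that decides Max Happy Edges and whose running time, for all inputs with $n\ge 1$ and $\ell\ge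 1$ and for every clique modulator $X$ of $G$, with $d=|X|$, is $O\bigl(\ell\cdot d^{d}\cdot(n+\sqrt n\,m)(n+m)\bigr)$, with an absolute constant and with $0^0=1$. (3) Let $X$ be a clique modulator of $G$ with $|X|=d$. If more than $d+1$ vertices of $V\setminus X$ are not precolored, then every coloring $c:V\to[\ell]$ that has the largest number of happy edges among all colorings extending $p$ gives one and the same color to all vertices of $V\setminus X$ that are not precolored. -/

import Mathlib

namespace HappyColoring

/-! ### Random access machines with unit cost

A program works on registers and on arrays that hold natural numbers (a given program names only
finitely many of each). The only arithmetic is addition and truncated subtraction, so that the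
contents of a cell cannot grow by more than about one bit per step. -/

/-- The memory of the machine: `reg i` is register `i`, and `arr a i` is cell `i` of array `a`. -/
structure State where
  reg : ℕ → ℕ
  arr : ℕ → ℕ → ℕ

/-- Expressions: constants, registers, sums, truncated differences, and array look-ups. -/
inductive Expr where
  | const (a : ℕ)
  | reg (i : ℕ)
  | add (e₁ e₂ : Expr)
  | sub (e₁ e₂ : Expr)
  | get (a : ℕ) (e : Expr)

/-- The value of an expression in a memory state. -/
def Expr.eval (s : State) : Expr → ℕ
  | const a => a
  | reg i => s.reg i
  | add e₁ e₂ => e₁.eval s + e₂.eval s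
  | sub e₁ e₂ => e₁.eval s - e₂.eval s
  | get a e => s.arr a (e.eval s)

/-- The number of steps for evaluating an expression: one per operation or operand. -/
def Expr.cost : Expr → ℕ
  | const _ => 1
  | reg _ => 1
  | add e₁ e₂ => e₁.cost + e₂.cost + 1
  | sub e₁ e₂ => e₁.cost + e₂.cost + 1
  | get _ e => e.cost + 1

/-- Programs. A condition is true if the expression is nonzero. -/
inductive Program where
  | skip
  | assign (i : ℕ) (e : Expr)
  | set (a : ℕ) (e₁ e₂ : Expr)
  | seq (P Q : Program)
  | ite (e : Expr) (P Q : Program)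
  | while (e : Expr) (P : Program)

/-- `Exec P s s' t`: started in the state `s`, the program `P` halts in the state `s'` after
exactly `t` steps. -/
inductive Exec : Program → State → State → ℕ → Prop where
  | skip (s : State) : Exec .skip s s 1
  | assign (s : State) (i : ℕ) (e : Expr) :
      Exec (.assign i e) s { s with reg := Function.update s.reg i (e.eval s) } (e.cost + 1)
  | set (s : State) (a : ℕ) (e₁ e₂ : Expr) :
      Exec (.set a e₁ e₂) s
        { s with
          arr := Function.update s.arr a (Function.update (s.arr a) (e₁.eval s) (e₂.eval s)) }
        (e₁.cost + e₂.cost + 1)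
  | seq {P Q : Program} {s s₁ s₂ : State} {t₁ t₂ : ℕ} :
      Exec P s s₁ t₁ → Exec Q s₁ s₂ t₂ → Exec (.seq P Q) s s₂ (t₁ + t₂)
  | ite_true {e : Expr} {P Q : Program} {s s' : State} {t : ℕ} :
      e.eval s ≠ 0 → Exec P s s' t → Exec (.ite e P Q) s s' (e.cost + 1 + t)
  | ite_false {e : Expr} {P Q : Program} {s s' : State} {t : ℕ} :
      e.eval s = 0 → Exec Q s s' t → Exec (.ite e P Q) s s' (e.cost + 1 + t)
  | while_true {e : Expr} {P : Program} {s s₁ s₂ : State} {t₁ t₂ : ℕ} :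
      e.eval s ≠ 0 → Exec P s s₁ t₁ → Exec (.while e P) s₁ s₂ t₂ →
        Exec (.while e P) s s₂ (e.cost + 1 + t₁ + t₂)
  | while_false {e : Expr} {P : Program} {s : State} :
      e.eval s = 0 → Exec (.while e P) s s (e.cost + 1)

/-- The machine is deterministic: the final state and the number of steps are unique. -/
theorem Exec.deterministic {P : Program} {s s₁ s₂ : State} {t₁ t₂ : ℕ}
    (h₁ : Exec P s s₁ t₁) (h₂ : Exec P s s₂ t₂) : s₁ = s₂ ∧ t₁ = t₂ := by
  induction h₁ generalizing s₂ t₂ with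
  | skip s => cases h₂; exact ⟨rfl, rfl⟩
  | assign s i e => cases h₂; exact ⟨rfl, rfl⟩
  | set s a e₁ e₂ => cases h₂; exact ⟨rfl, rfl⟩
  | seq _ _ ih₁ ih₂ =>
    cases h₂ with
    | seq g₁ g₂ =>
      obtain ⟨rfl, rfl⟩ := ih₁ g₁
      obtain ⟨rfl, rfl⟩ := ih₂ g₂
      exact ⟨rfl, rfl⟩
  | ite_true h _ ih =>
    cases h₂ with
    | ite_true _ g => obtain ⟨rfl, rfl⟩ := ih g; exact ⟨rfl, rfl⟩
    | ite_false g _ => exact absurd g h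
  | ite_false h _ ih =>
    cases h₂ with
    | ite_true g _ => exact absurd h g
    | ite_false _ g => obtain ⟨rfl, rfl⟩ := ih g; exact ⟨rfl, rfl⟩
  | while_true h _ _ ih₁ ih₂ =>
    cases h₂ with
    | while_true _ g₁ g₂ =>
      obtain ⟨rfl, rfl⟩ := ih₁ g₁
      obtain ⟨rfl, rfl⟩ := ih₂ g₂
      exact ⟨rfl, rfl⟩
    | while_false g => exact absurd g h
  | while_false h =>
    cases h₂ with
    | while_true g _ _ => exact absurd h g
    | while_false _ => exact ⟨rfl, rfl⟩

/-! ### Happy vertices and happy edges -/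

/-- `c` extends the partial coloring `p` (where `none` means not precolored). -/
def Extends {V C : Type*} (p : V → Option C) (c : V → C) : Prop :=
  ∀ v a, p v = some a → c v = a

/-- The vertices all of whose neighbors have the same color as the vertex itself. -/
def happyVertices {V C : Type*} (G : SimpleGraph V) (c : V → C) : Set V :=
  {v | ∀ u, G.Adj v u → c u = c v}

/-- The edges both of whose end points have the same color. -/
def happyEdges {V C : Type*} (G : SimpleGraph V) (c : V → C) : Set (Sym2 V) :=
  {e | e ∈ G.edgeSet ∧ ∀ u ∈ e, ∀ v ∈ e, c u = c v}

/-- `c` extends `p` and has the largest number of happy edges among all colorings that do. -/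
def IsOptimalForEdges {V C : Type*} (G : SimpleGraph V) (p : V → Option C) (c : V → C) : Prop :=
  Extends p c ∧ ∀ c' : V → C, Extends p c' → (happyEdges G c').ncard ≤ (happyEdges G c).ncard

/-- `X` is a clique modulator of `G`: deleting `X` leaves a clique. -/
def IsCliqueModulator {V : Type*} (G : SimpleGraph V) (X : Finset V) : Prop :=
  G.IsClique {v | v ∉ X}

/-! ### The computational problems -/

/-- Inputs: a graph `G` on `n` vertices, a partial coloring `p` with colors from a set of `l`
colors, and a positive integer `k`. -/
structure Instance where
  n : ℕ
  l : ℕ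
  k : ℕ
  k_pos : 0 < k
  G : SimpleGraph (Fin n)
  p : Fin n → Option (Fin l)

/-- Max Happy Vertices: is there an extension with at least `k` happy vertices? -/
def MaxHappyVertices (I : Instance) : Prop :=
  ∃ c : Fin I.n → Fin I.l, Extends I.p c ∧ I.k ≤ (happyVertices I.G c).ncard

/-- Max Happy Edges: is there an extension with at least `k` happy edges? -/
def MaxHappyEdges (I : Instance) : Prop :=
  ∃ c : Fin I.n → Fin I.l, Extends I.p c ∧ I.k ≤ (happyEdges I.G c).ncard

/-- The number of edges. -/
noncomputable def Instance.m (I : Instance) : ℕ := I.G.edgeSet.ncard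

/-- The parameter: the least size of a clique modulator of the graph. -/
noncomputable def distToClique (I : Instance) : ℕ :=
  sInf {d | ∃ X : Finset (Fin I.n), IsCliqueModulator I.G X ∧ X.card = d}

/-- The size of an input in bits: the adjacency matrix, the precoloring as a list of `n` numbers
from `0` to `l`, and the numbers `n`, `l`, `k`, all in binary. -/
def Instance.size (I : Instance) : ℕ :=
  I.n ^ 2 + I.n * Nat.size I.l + Nat.size I.n + Nat.size I.l + Nat.size I.k

open Classical in
/-- The initial memory. Registers `0`, `1`, `2` hold `n`, `l`, `k`; array `0` holds the adjacency
matrix, row by row; array `1` holds the precoloring, with `0` for vertices that are not precolored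
and `j + 1` for the color `j`. Everything else is `0`. -/
noncomputable def Instance.toState (I : Instance) : State where
  reg i := if i = 0 then I.n else if i = 1 then I.l else if i = 2 then I.k else 0
  arr a i :=
    if a = 0 then
      if ∃ u v : Fin I.n, I.G.Adj u v ∧ i = u.val * I.n + v.val then 1 else 0
    else if a = 1 then
      if h : i < I.n then
        match I.p ⟨i, h⟩ with
        | none => 0
        | some j => j.val + 1
      else 0
    else 0

/-- `P` halts on input `I` after at most `T` steps, and its answer (`1` in register `0` for yes,
anything else for no) is correct for the decision problem `A`. -/
def DecidesWithin (P : Program) (A : Instance → Prop) (I : Instance) (T : ℝ) : Prop :=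
  ∃ s t, Exec P I.toState s t ∧ (t : ℝ) ≤ T ∧ (s.reg 0 = 1 ↔ A I)

/-- `A` is fixed-parameter tractable with respect to the parameter `κ`: one algorithm decides `A`
in time `f(κ) · |I| ^ c` for a computable function `f` and a constant `c`. -/
def IsFPT (A : Instance → Prop) (κ : Instance → ℕ) : Prop :=
  ∃ (P : Program) (f : ℕ → ℕ) (c : ℕ), Computable f ∧
    ∀ I : Instance, DecidesWithin P A I ((f (κ I) * I.size ^ c : ℕ) : ℝ)

end HappyColoring

/-! Both problems reduce to distributing a few groups of uncolored vertices among a few colors; the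
number of groups depends only on the distance to clique.

Edges: let `X` be a clique modulator, `U` the uncolored vertices outside `X`, and `c` an optimal
coloring. For a color `a`, let `n a` and `u a` count the precolored and the uncolored vertices of
color `a` outside `X`, let `k a = n a + u a`, and let `d a` count the vertices of color `a` in `X`.
If `b` occurs on `U` and `a ≠ b`, recoloring the vertices of `U` of color `b` with `a` gains at
least `u b * k a` happy edges and loses at most `u b * (n b + d b)`, so `k a ≤ n b + d b`. If two
colors occurred on `U`, summing these inequalities suitably would give `U.card ≤ X.card`. So `c` is
constant on `U` as soon as `U` has more than `X.card` elements (`IsOptimalForEdges.card_le`,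
`IsOptimalForEdges.eq_of_card_lt`). This gives the structural claim, and it allows treating `U` as
one group when it is large.

Vertices: uncolored clique vertices with the same neighbors in `X` may copy the color of one
representative without making a happy vertex unhappy (`happyVertices_subset_of_representatives`).

The algorithm finds a modulator itself: the vertices of a greedy maximal matching in the complement
graph, at most twice the optimum (`Instance.card_modulator_le`). This leaves at most `4 * d + 1`
groups for edges and `2 * d + 2 ^ (2 * d)` for vertices. By renaming, at most `2 * n` colors need to
be considered (`Instance.exists_rename`). The value of a coloring is the sum of the values of its
color classes, so a dynamic program over pairs of a number of colors and a set of groups is exact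
(`Instance.problem_iff_opt`).

The machine model is handled by a small calculus: `Impl Γ f a b` says that `f` is computed in time
`O((N + 1) ^ a * (M + 1) ^ b)`, with closure under arithmetic, branching, bounded loops and table
look-up. The scales `N = 2 * n` and `M = 2 ^ t`, where `t` is the number of groups, serve only for
the analysis; the program computes `t` itself. The bound for edges follows because either `n ≤ 2 * d
+ 1` or `n ^ 2 ≤ 8 * m`, and because `B ^ d = O(d ^ d)` for every constant `B`. -/

namespace HappyColoring

/-! ### Counted loops -/

/-- Run `P` while register `i`, which is incremented after each round, is below register `b`. -/
def Program.loop (i b : ℕ) (P : Program) : Program :=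
  .while (.sub (.reg b) (.reg i)) (.seq P (.assign i (.add (.reg i) (.const 1))))

/-- Induction on the number `m` of remaining rounds. The invariant is indexed by the counter and is
asserted of the state after the increment. Each round adds 4 steps for the test and 4 for the
increment to the time of the body; the last 4 steps are the failing test. -/
theorem Exec.loop {i b n T : ℕ} {P : Program} (Inv : ℕ → State → Prop) (hib : b ≠ i)
    (hP : ∀ x < n, ∀ s, Inv x s → s.reg i = x → s.reg b = n →
      ∃ s' t, Exec P s s' t ∧ t ≤ T ∧ s'.reg i = x ∧ s'.reg b = n ∧
        Inv (x + 1) { s' with reg := Function.update s'.reg i (x + 1) }) :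
    ∀ (m x : ℕ) (s : State), x + m = n → s.reg i = x → s.reg b = n → Inv x s →
      ∃ s' t, Exec (.loop i b P) s s' t ∧ t ≤ m * (T + 8) + 4 ∧ Inv n s' := by
  intro m
  induction m with
  | zero =>
    intro x s hx hi hb h
    refine ⟨s, _, Exec.while_false ?_, ?_, ?_⟩
    · simp only [Expr.eval]; omega
    · simp [Expr.cost]
    · obtain rfl : x = n := by omega
      exact h
  | succ m ih =>
    intro x s hx hi hb h
    obtain ⟨s₁, t₁, h₁, ht₁, hi₁, hb₁, hI⟩ := hP x (by omega) s h hi hb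
    obtain ⟨s₂, t₂, h₂, ht₂, hI₂⟩ := ih (x + 1)
      { s₁ with reg := Function.update s₁.reg i (x + 1) } (by omega) (by simp)
      (by simp [Function.update_of_ne hib, hb₁]) hI
    have h₃ := Exec.assign s₁ i (.add (.reg i) (.const 1))
    simp only [Expr.eval, hi₁] at h₃
    refine ⟨s₂, _, Exec.while_true ?_ (Exec.seq h₁ h₃) h₂, ?_, hI₂⟩
    · simp only [Expr.eval]; omega
    · simp only [Expr.cost]
      have : (m + 1) * (T + 8) = m * (T + 8) + (T + 8) := by ring
      omega

/-! ### Functions computed by programs -/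

/-- A description of the states in which a piece of a program runs. The context `g : γ` collects
the data that the program works on, and `R g s` says how they are stored in the state `s`. Only the
first `k` registers and the first `na` arrays are used for that. The numbers `N g` and `M g` are the
scales in which running times are measured. -/
structure Ctx (γ : Type) where
  D : γ → Prop
  R : γ → State → Prop
  k : ℕ
  na : ℕ
  N : γ → ℕ
  M : γ → ℕ
  stable : ∀ g s s', R g s → (∀ r < k, s'.reg r = s.reg r) → (∀ a < na, s'.arr a = s.arr a) → R g s'

namespace Ctx

variable {γ : Type}

/-- The scale `(N + 1) ^ a * (M + 1) ^ b`. -/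
def cost (Γ : Ctx γ) (a b : ℕ) (g : γ) : ℕ := (Γ.N g + 1) ^ a * (Γ.M g + 1) ^ b

theorem one_le_cost (Γ : Ctx γ) (a b : ℕ) (g : γ) : 1 ≤ Γ.cost a b g :=
  Nat.mul_pos (by positivity) (by positivity)

theorem cost_mono (Γ : Ctx γ) {a b a' b' : ℕ} (ha : a ≤ a') (hb : b ≤ b') (g : γ) :
    Γ.cost a b g ≤ Γ.cost a' b' g :=
  Nat.mul_le_mul (Nat.pow_le_pow_right (by omega) ha) (Nat.pow_le_pow_right (by omega) hb)

theorem cost_add (Γ : Ctx γ) (a b a' b' : ℕ) (g : γ) :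
    Γ.cost (a + a') (b + b') g = Γ.cost a b g * Γ.cost a' b' g := by
  simp only [cost, pow_add]; ring

/-- A loop variable below `b`, in register `k + j + 1`. -/
def push (Γ : Ctx γ) (j : ℕ) (b : γ → ℕ) : Ctx (γ × ℕ) where
  D q := Γ.D q.1 ∧ q.2 < b q.1
  R q s := Γ.R q.1 s ∧ s.reg (Γ.k + j + 1) = q.2
  -- Three registers are reserved for a loop: the accumulator `k + j`, the loop variable `k + j + 1`
  -- and the bound `k + j + 2`. The offset `j` leaves room for intermediate results that are alive
  -- around the loop.
  k := Γ.k + j + 3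
  na := Γ.na
  N q := Γ.N q.1
  M q := Γ.M q.1
  stable q s s' h hr ha :=
    ⟨Γ.stable _ _ _ h.1 (fun r hk => hr r (by omega)) ha, (hr _ (by omega)).trans h.2⟩

/-- An accumulator in register `k + j` in addition to the loop variable. -/
def pushAcc (Γ : Ctx γ) (j : ℕ) (b : γ → ℕ) : Ctx ((γ × ℕ) × ℕ) where
  D q := (Γ.push j b).D q.1
  R q s := (Γ.push j b).R q.1 s ∧ s.reg (Γ.k + j) = q.2
  k := Γ.k + j + 3
  na := Γ.na
  N q := Γ.N q.1.1
  M q := Γ.M q.1.1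
  stable q s s' h hr ha :=
    ⟨(Γ.push j b).stable _ _ _ h.1 hr ha, (hr _ (by omega)).trans h.2⟩

/-- The array `a` holds the first `len` values of `A`. -/
def HasArr (Γ : Ctx γ) (a : ℕ) (len : γ → ℕ) (A : γ → ℕ → ℕ) : Prop :=
  ∀ g s, Γ.D g → Γ.R g s → ∀ i < len g, s.arr a i = A g i

/-- `Γ'` refines `Γ` along `π`. -/
structure Le {γ' : Type} (Γ : Ctx γ) (Γ' : Ctx γ') (π : γ' → γ) : Prop where
  D : ∀ q, Γ'.D q → Γ.D (π q)
  R : ∀ q s, Γ'.D q → Γ'.R q s → Γ.R (π q) s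
  k : Γ.k ≤ Γ'.k
  N : ∀ q, Γ'.N q = Γ.N (π q)
  M : ∀ q, Γ'.M q = Γ.M (π q)

theorem HasArr.lift {γ' : Type} {Γ : Ctx γ} {Γ' : Ctx γ'} {π : γ' → γ} (h : Γ.Le Γ' π) {a : ℕ}
    {len : γ → ℕ} {A : γ → ℕ → ℕ} (hA : Γ.HasArr a len A) :
    Γ'.HasArr a (fun q => len (π q)) (fun q => A (π q)) :=
  fun q s hD hR => hA (π q) s (h.D q hD) (h.R q s hD hR)

theorem le_refl (Γ : Ctx γ) : Γ.Le Γ id :=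
  ⟨fun _ h => h, fun _ _ _ h => h, le_rfl, fun _ => rfl, fun _ => rfl⟩

theorem Le.push {γ₀ : Type} {Γ₀ : Ctx γ₀} {Γ : Ctx γ} {π : γ → γ₀} (h : Γ₀.Le Γ π) (j : ℕ)
    (b : γ → ℕ) : Γ₀.Le (Γ.push j b) (fun q => π q.1) where
  D q hq := h.D _ hq.1
  R q s hD hR := h.R _ s hD.1 hR.1
  k := h.k.trans (by simp only [Ctx.push]; omega)
  N q := h.N q.1
  M q := h.M q.1

theorem le_push (Γ : Ctx γ) (j : ℕ) (b : γ → ℕ) : Γ.Le (Γ.push j b) Prod.fst :=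
  Γ.le_refl.push j b

theorem le_pushAcc (Γ : Ctx γ) (j : ℕ) (b : γ → ℕ) : (Γ.push j b).Le (Γ.pushAcc j b) Prod.fst :=
  ⟨fun _ h => h, fun _ _ _ h => h.1, le_rfl, fun _ => rfl, fun _ => rfl⟩

/-- The context with an additional assumption. -/
def assume (Γ : Ctx γ) (p : γ → Prop) : Ctx γ where
  D g := Γ.D g ∧ p g
  R := Γ.R
  k := Γ.k
  na := Γ.na
  N := Γ.N
  M := Γ.M
  stable := Γ.stable

theorem le_assume (Γ : Ctx γ) (p : γ → Prop) : Γ.Le (Γ.assume p) id :=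
  ⟨fun _ h => h.1, fun _ _ _ h => h, le_rfl, fun _ => rfl, fun _ => rfl⟩

end Ctx

/-- In the context `Γ`, the function `f` is computed by a program in time
`O ((N + 1) ^ a * (M + 1) ^ b)`; the result can be put into any register that is not in use. -/
def Impl {γ : Type} (Γ : Ctx γ) (f : γ → ℕ) (a b : ℕ) : Prop :=
  ∀ j, ∃ P C, ∀ g s, Γ.D g → Γ.R g s → ∃ s' t, Exec P s s' t ∧ t ≤ C * Γ.cost a b g ∧
    s'.reg (Γ.k + j) = f g ∧ (∀ r < Γ.k + j, s'.reg r = s.reg r) ∧ s'.arr = s.arr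

open Classical in
/-- The indicator of a proposition. -/
noncomputable def ind (p : Prop) : ℕ := if p then 1 else 0

@[simp] theorem ind_of_true {p : Prop} (h : p) : ind p = 1 := by simp [ind, h]
@[simp] theorem ind_of_false {p : Prop} (h : ¬p) : ind p = 0 := by simp [ind, h]

theorem ind_pos {p : Prop} : 0 < ind p ↔ p := by by_cases h : p <;> simp [h]

theorem ind_congr {p q : Prop} (h : p ↔ q) : ind p = ind q := by rw [propext h]

theorem ind_mono {p q : Prop} (h : p → q) : ind p ≤ ind q := by
  by_cases hp : p
  · simp [hp, h hp]
  · simp [hp]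

/-- In the context `Γ`, the predicate `p` is decided by a program. -/
def ImplP {γ : Type} (Γ : Ctx γ) (p : γ → Prop) (a b : ℕ) : Prop :=
  Impl Γ (fun g => ind (p g)) a b

/-! ### Closure properties of computed functions -/

namespace Impl

variable {γ γ' : Type} {Γ : Ctx γ} {Γ' : Ctx γ'} {f f₁ f₂ : γ → ℕ} {a b : ℕ}

theorem mono {a' b' : ℕ} (h : Impl Γ f a b) (ha : a ≤ a') (hb : b ≤ b') : Impl Γ f a' b' := by
  intro j
  obtain ⟨P, C, hP⟩ := h j
  refine ⟨P, C, fun g s hD hR => ?_⟩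
  obtain ⟨s', t, h₁, h₂, h₃⟩ := hP g s hD hR
  exact ⟨s', t, h₁, h₂.trans (Nat.mul_le_mul_left _ (Γ.cost_mono ha hb g)), h₃⟩

theorem congr (h : Impl Γ f₁ a b) (hf : ∀ g, Γ.D g → f₁ g = f₂ g) : Impl Γ f₂ a b := by
  intro j
  obtain ⟨P, C, hP⟩ := h j
  refine ⟨P, C, fun g s hD hR => ?_⟩
  rw [← hf g hD]
  exact hP g s hD hR

/-- The registers between `Γ.k` and `Γ'.k` hold data unknown to `Γ`. They survive because the result
is requested at the offset `d + j` with `Γ'.k = Γ.k + d`, and a program leaves everything below its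
target untouched. -/
theorem lift {π : γ' → γ} (hπ : Γ.Le Γ' π) (h : Impl Γ f a b) :
    Impl Γ' (fun q => f (π q)) a b := by
  intro j
  obtain ⟨d, hd⟩ := Nat.exists_eq_add_of_le hπ.k
  obtain ⟨P, C, hP⟩ := h (d + j)
  refine ⟨P, C, fun q s hD hR => ?_⟩
  obtain ⟨s', t, h₁, h₂, h₃⟩ := hP (π q) s (hπ.D q hD) (hπ.R q s hD hR)
  rw [← add_assoc, ← hd] at h₃
  refine ⟨s', t, h₁, ?_, h₃⟩
  simpa only [Ctx.cost, hπ.N, hπ.M] using h₂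

/-- Change of all registers from `k` on, and of nothing else, does not matter. -/
theorem stable_of_frame {j : ℕ} {g : γ} {s s' : State} (h : Γ.R g s)
    (hr : ∀ r < Γ.k + j, s'.reg r = s.reg r) (ha : s'.arr = s.arr) : Γ.R g s' :=
  Γ.stable g s s' h (fun r hk => hr r (by omega)) (fun a _ => by rw [ha])

theorem of_expr (e : Expr) (he : ∀ g s, Γ.D g → Γ.R g s → e.eval s = f g) : Impl Γ f a b := by
  intro j
  refine ⟨.assign (Γ.k + j) e, e.cost + 1, fun g s hD hR => ⟨_, _, Exec.assign _ _ _, ?_, ?_, ?_, rfl⟩⟩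
  · exact Nat.le_mul_of_pos_right _ (Γ.one_le_cost a b g)
  · simpa using he g s hD hR
  · intro r hr
    simp [Function.update_of_ne hr.ne]

theorem const (c : ℕ) : Impl Γ (fun _ => c) a b := of_expr (.const c) fun _ _ _ _ => rfl

theorem reg (i : ℕ) (h : ∀ g s, Γ.D g → Γ.R g s → s.reg i = f g) : Impl Γ f a b :=
  of_expr (.reg i) h

/-- The innermost loop variable. -/
theorem var {c : γ → ℕ} {j : ℕ} : Impl (Γ.push j c) (fun q => q.2) a b :=
  reg _ fun _ _ _ h => h.2

/-- The composition with an expression in the result. -/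
theorem map₁ (h : Impl Γ f a b) (F : ℕ → Expr) (φ : γ → ℕ)
    (hF : ∀ g s i, Γ.D g → Γ.R g s → s.reg i = f g → (F i).eval s = φ g) :
    Impl Γ φ a b := by
  intro j
  obtain ⟨P, C, hP⟩ := h j
  refine ⟨.seq P (.assign (Γ.k + j) (F (Γ.k + j))), C + ((F (Γ.k + j)).cost + 1), fun g s hD hR => ?_⟩
  obtain ⟨s', t, h₁, h₂, h₃, h₄, h₅⟩ := hP g s hD hR
  refine ⟨_, _, h₁.seq (Exec.assign _ _ _), ?_, ?_, ?_, h₅⟩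
  · rw [add_mul]
    exact add_le_add h₂ (Nat.le_mul_of_pos_right _ (Γ.one_le_cost a b g))
  · simpa using hF g s' _ hD (stable_of_frame hR h₄ h₅) h₃
  · intro r hr
    simp [Function.update_of_ne hr.ne, h₄ r hr]

/-- The composition of two results in an expression. -/
theorem map₂ (h₁ : Impl Γ f₁ a b) (h₂ : Impl Γ f₂ a b) (F : ℕ → ℕ → Expr) (φ : γ → ℕ)
    (hF : ∀ g s i j, s.reg i = f₁ g → s.reg j = f₂ g → (F i j).eval s = φ g) :
    Impl Γ φ a b := by
  intro j
  obtain ⟨P, C, hP⟩ := h₁ j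
  obtain ⟨Q, C', hQ⟩ := h₂ (j + 1)
  refine ⟨.seq P (.seq Q (.assign (Γ.k + j) (F (Γ.k + j) (Γ.k + (j + 1))))),
    C + (C' + ((F (Γ.k + j) (Γ.k + (j + 1))).cost + 1)), fun g s hD hR => ?_⟩
  obtain ⟨s₁, t₁, x₁, x₂, x₃, x₄, x₅⟩ := hP g s hD hR
  obtain ⟨s₂, t₂, y₁, y₂, y₃, y₄, y₅⟩ := hQ g s₁ hD (stable_of_frame hR x₄ x₅)
  refine ⟨_, _, x₁.seq (y₁.seq (Exec.assign _ _ _)), ?_, ?_, ?_, y₅.trans x₅⟩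
  · rw [add_mul, add_mul]
    exact add_le_add x₂ (add_le_add y₂ (Nat.le_mul_of_pos_right _ (Γ.one_le_cost a b g)))
  · simpa using hF g s₂ _ _ ((y₄ _ (by omega)).trans x₃) y₃
  · intro r hr
    simp [Function.update_of_ne hr.ne, y₄ r (by omega), x₄ r hr]

theorem add (h₁ : Impl Γ f₁ a b) (h₂ : Impl Γ f₂ a b) : Impl Γ (fun g => f₁ g + f₂ g) a b :=
  map₂ h₁ h₂ (fun i j => .add (.reg i) (.reg j)) _ fun g s i j hi hj => by simp [Expr.eval, hi, hj]

theorem sub (h₁ : Impl Γ f₁ a b) (h₂ : Impl Γ f₂ a b) : Impl Γ (fun g => f₁ g - f₂ g) a b :=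
  map₂ h₁ h₂ (fun i j => .sub (.reg i) (.reg j)) _ fun g s i j hi hj => by simp [Expr.eval, hi, hj]

theorem max (h₁ : Impl Γ f₁ a b) (h₂ : Impl Γ f₂ a b) : Impl Γ (fun g => f₁ g ⊔ f₂ g) a b :=
  map₂ h₁ h₂ (fun i j => .add (.reg i) (.sub (.reg j) (.reg i))) _ fun g s i j hi hj => by
    simp only [Expr.eval, hi, hj]; omega

theorem get {i : ℕ} {len : γ → ℕ} {A : γ → ℕ → ℕ} (hA : Γ.HasArr i len A) (h : Impl Γ f a b)
    (hf : ∀ g, Γ.D g → f g < len g) : Impl Γ (fun g => A g (f g)) a b :=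
  map₁ h (fun r => .get i (.reg r)) _ fun g s r hD hR hr => by
    simp only [Expr.eval, hr]
    exact hA g s hD hR _ (hf g hD)

/-- Each branch only has to be correct when its condition holds. This matters for table look-ups
whose index is in range only in that branch. -/
theorem ite_assume {p : γ → Prop} {dec : ∀ g, Decidable (p g)} (hp : ImplP Γ p a b)
    (h₁ : Impl (Γ.assume p) f₁ a b) (h₂ : Impl (Γ.assume fun g => ¬p g) f₂ a b) :
    Impl Γ (fun g => if p g then f₁ g else f₂ g) a b := by
  intro j
  obtain ⟨P, C, hP⟩ := hp j
  obtain ⟨P₁, C₁, hP₁⟩ := h₁ j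
  obtain ⟨P₂, C₂, hP₂⟩ := h₂ j
  refine ⟨.seq P (.ite (.reg (Γ.k + j)) P₁ P₂), C + (2 + (C₁ + C₂)), fun g s hD hR => ?_⟩
  obtain ⟨s₀, t₀, x₁, x₂, x₃, x₄, x₅⟩ := hP g s hD hR
  have hR₀ := stable_of_frame hR x₄ x₅
  have h2 : 2 ≤ 2 * Γ.cost a b g := Nat.le_mul_of_pos_right _ (Γ.one_le_cost a b g)
  by_cases hpg : p g
  · obtain ⟨s₁, t₁, y₁, y₂, y₃, y₄, y₅⟩ := hP₁ g s₀ ⟨hD, hpg⟩ hR₀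
    have y₃' : s₁.reg (Γ.k + j) = f₁ g := y₃
    refine ⟨s₁, _, x₁.seq (Exec.ite_true ?_ y₁), ?_, by simpa [hpg] using y₃',
      fun r hr => (y₄ r hr).trans (x₄ r hr), y₅.trans x₅⟩
    · simp [Expr.eval, x₃, hpg]
    · have h : t₁ ≤ C₁ * Γ.cost a b g := y₂
      simp only [Expr.cost, add_mul]; omega
  · obtain ⟨s₁, t₁, y₁, y₂, y₃, y₄, y₅⟩ := hP₂ g s₀ ⟨hD, hpg⟩ hR₀
    have y₃' : s₁.reg (Γ.k + j) = f₂ g := y₃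
    refine ⟨s₁, _, x₁.seq (Exec.ite_false ?_ y₁), ?_, by simpa [hpg] using y₃',
      fun r hr => (y₄ r hr).trans (x₄ r hr), y₅.trans x₅⟩
    · simp [Expr.eval, x₃, hpg]
    · have h : t₁ ≤ C₂ * Γ.cost a b g := y₂
      simp only [Expr.cost, add_mul]; omega

theorem ite {p : γ → Prop} {dec : ∀ g, Decidable (p g)} (hp : ImplP Γ p a b) (h₁ : Impl Γ f₁ a b)
    (h₂ : Impl Γ f₂ a b) : Impl Γ (fun g => if p g then f₁ g else f₂ g) a b :=
  ite_assume hp (h₁.lift (Γ.le_assume _)) (h₂.lift (Γ.le_assume _))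

/-- Primitive recursion with a loop bound. -/
theorem fold {c init : γ → ℕ} {body : γ → ℕ → ℕ → ℕ} {a' b' : ℕ}
    (hc : Impl Γ c (a + a') (b + b')) (hinit : Impl Γ init (a + a') (b + b'))
    (hbody : ∀ j, Impl (Γ.pushAcc j c) (fun q => body q.1.1 q.1.2 q.2) a b)
    (hle : ∀ g, Γ.D g → c g ≤ Γ.cost a' b' g) :
    Impl Γ (fun g => Nat.rec (init g) (fun x v => body g x v) (c g)) (a + a') (b + b') := by
  intro j
  obtain ⟨P, C, hP⟩ := hinit j
  obtain ⟨Q, C', hQ⟩ := hc (j + 2)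
  obtain ⟨B, C'', hB⟩ := hbody j 0
  set k := Γ.k + j with hk
  have hkB : (Γ.pushAcc j c).k + 0 = k + 3 := rfl
  rw [hkB] at hB
  -- Relative to `k`: the accumulator is register `k`, the counter `k + 1`, the bound `k + 2`, and
  -- the body leaves its result in `k + 3`. The constants are 2 for resetting the counter, `10 = 2 +
  -- 8` per round for the copy and the loop overhead, and 4 for the last test.
  refine ⟨.seq P (.seq Q (.seq (.assign (k + 1) (.const 0))
    (.loop (k + 1) (k + 2) (.seq B (.assign k (.reg (k + 3))))))),
    C + C' + 2 + (C'' + 10) + 4, fun g s hD hR => ?_⟩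
  obtain ⟨s₁, t₁, x₁, x₂, x₃, x₄, x₅⟩ := hP g s hD hR
  obtain ⟨s₂, t₂, y₁, y₂, y₃, y₄, y₅⟩ := hQ g s₁ hD (stable_of_frame hR x₄ x₅)
  rw [← add_assoc, ← hk] at y₃ y₄
  let F : ℕ → ℕ := fun m => Nat.rec (init g) (fun x v => body g x v) m
  obtain ⟨s₃, t₃, z₁, z₂, z₃, z₄, z₅⟩ := Exec.loop (i := k + 1) (b := k + 2) (n := c g)
    (T := C'' * Γ.cost a b g + 2) (P := .seq B (.assign k (.reg (k + 3))))
    (fun x s' => s'.reg k = F x ∧ (∀ r < k, s'.reg r = s.reg r) ∧ s'.arr = s.arr) (by omega) (by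
      rintro x hx s' ⟨h₁, h₂, h₃⟩ hi hb
      obtain ⟨s'', t, w₁, w₂, w₃, w₄, w₅⟩ := hB ((g, x), F x) s' ⟨hD, hx⟩
        ⟨⟨stable_of_frame hR h₂ h₃, hi⟩, h₁⟩
      refine ⟨_, _, w₁.seq (Exec.assign _ _ _), ?_, ?_, ?_, ?_, ?_, w₅.trans h₃⟩
      · exact add_le_add w₂ le_rfl
      · dsimp only
        rw [Function.update_of_ne (by omega), w₄ _ (by omega), hi]
      · dsimp only
        rw [Function.update_of_ne (by omega), w₄ _ (by omega), hb]
      · simp only [Expr.eval]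
        rw [Function.update_of_ne (by omega), Function.update_self, w₃]
      · intro r hr
        simp only [Expr.eval]
        rw [Function.update_of_ne (by omega), Function.update_of_ne (by omega), w₄ _ (by omega),
          h₂ r hr]) (c g) 0
    { s₂ with reg := Function.update s₂.reg (k + 1) 0 } (by omega) (by simp)
    (by dsimp only; rw [Function.update_of_ne (by omega), y₃])
    ⟨by dsimp only; rw [Function.update_of_ne (by omega), y₄ _ (by omega)]; exact x₃,
      fun r hr => by dsimp only; rw [Function.update_of_ne (by omega), y₄ _ (by omega), x₄ r hr],
      y₅.trans x₅⟩
  refine ⟨s₃, _, x₁.seq (y₁.seq ((Exec.assign _ _ _).seq z₁)), ?_, z₃, z₄, z₅⟩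
  have h1 := Γ.one_le_cost a b g
  have h2 := Γ.one_le_cost (a + a') (b + b') g
  have h3 : c g * (C'' * Γ.cost a b g + 2 + 8) ≤ (C'' + 10) * Γ.cost (a + a') (b + b') g := by
    rw [Γ.cost_add]
    calc c g * (C'' * Γ.cost a b g + 2 + 8)
        ≤ Γ.cost a' b' g * ((C'' + 10) * Γ.cost a b g) := by
          apply Nat.mul_le_mul (hle g hD)
          rw [add_mul]; omega
      _ = _ := by ring
  simp only [Expr.cost, add_mul] at h3 ⊢
  omega

theorem foldN {c init : γ → ℕ} {body : γ → ℕ → ℕ → ℕ}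
    (hc : Impl Γ c (a + 1) b) (hinit : Impl Γ init (a + 1) b)
    (hbody : ∀ j, Impl (Γ.pushAcc j c) (fun q => body q.1.1 q.1.2 q.2) a b)
    (hle : ∀ g, Γ.D g → c g ≤ Γ.N g + 1) :
    Impl Γ (fun g => Nat.rec (init g) (fun x v => body g x v) (c g)) (a + 1) b :=
  fold (b' := 0) hc hinit hbody fun g hD => by simpa [Ctx.cost] using hle g hD

theorem foldM {c init : γ → ℕ} {body : γ → ℕ → ℕ → ℕ}
    (hc : Impl Γ c a (b + 1)) (hinit : Impl Γ init a (b + 1))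
    (hbody : ∀ j, Impl (Γ.pushAcc j c) (fun q => body q.1.1 q.1.2 q.2) a b)
    (hle : ∀ g, Γ.D g → c g ≤ Γ.M g + 1) :
    Impl Γ (fun g => Nat.rec (init g) (fun x v => body g x v) (c g)) a (b + 1) :=
  fold (a' := 0) hc hinit hbody fun g hD => by simpa [Ctx.cost] using hle g hD

theorem sum_eq_rec (F : ℕ → ℕ) (n : ℕ) :
    ∑ x ∈ Finset.range n, F x = Nat.rec 0 (fun x v => v + F x) n := by
  induction n with
  | zero => rfl
  | succ n ih => rw [Finset.sum_range_succ, ih]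

theorem sumN {c : γ → ℕ} {F : γ → ℕ → ℕ} (hc : Impl Γ c (a + 1) b)
    (hF : ∀ j, Impl (Γ.push j c) (fun q => F q.1 q.2) a b)
    (hle : ∀ g, Γ.D g → c g ≤ Γ.N g + 1) :
    Impl Γ (fun g => ∑ x ∈ Finset.range (c g), F g x) (a + 1) b := by
  simp only [sum_eq_rec]
  exact foldN (body := fun g x v => v + F g x) hc (const 0)
    (fun j => add (reg (Γ.k + j) fun q s _ h => h.2) ((hF j).lift (Γ.le_pushAcc j c))) hle

theorem sumM {c : γ → ℕ} {F : γ → ℕ → ℕ} (hc : Impl Γ c a (b + 1))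
    (hF : ∀ j, Impl (Γ.push j c) (fun q => F q.1 q.2) a b)
    (hle : ∀ g, Γ.D g → c g ≤ Γ.M g + 1) :
    Impl Γ (fun g => ∑ x ∈ Finset.range (c g), F g x) a (b + 1) := by
  simp only [sum_eq_rec]
  exact foldM (body := fun g x v => v + F g x) hc (const 0)
    (fun j => add (reg (Γ.k + j) fun q s _ h => h.2) ((hF j).lift (Γ.le_pushAcc j c))) hle

theorem sup_eq_rec (F : ℕ → ℕ) (n : ℕ) :
    (Finset.range n).sup F = Nat.rec 0 (fun x v => v ⊔ F x) n := by
  induction n with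
  | zero => rfl
  | succ n ih => rw [Finset.range_add_one, Finset.sup_insert, ih, sup_comm]

theorem supM {c : γ → ℕ} {F : γ → ℕ → ℕ} (hc : Impl Γ c a (b + 1))
    (hF : ∀ j, Impl (Γ.push j c) (fun q => F q.1 q.2) a b)
    (hle : ∀ g, Γ.D g → c g ≤ Γ.M g + 1) :
    Impl Γ (fun g => (Finset.range (c g)).sup (F g)) a (b + 1) := by
  simp only [sup_eq_rec]
  exact foldM (body := fun g x v => v ⊔ F g x) hc (const 0)
    (fun j => max (reg (Γ.k + j) fun q s _ h => h.2) ((hF j).lift (Γ.le_pushAcc j c))) hle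

theorem mulN (h₁ : Impl Γ f₁ (a + 1) b) (h₂ : Impl Γ f₂ a b) (hle : ∀ g, Γ.D g → f₁ g ≤ Γ.N g + 1) :
    Impl Γ (fun g => f₁ g * f₂ g) (a + 1) b :=
  (sumN (F := fun g _ => f₂ g) h₁ (fun j => h₂.lift (Γ.le_push j f₁)) hle).congr fun g _ => by simp

theorem mulM (h₁ : Impl Γ f₁ a (b + 1)) (h₂ : Impl Γ f₂ a b) (hle : ∀ g, Γ.D g → f₁ g ≤ Γ.M g + 1) :
    Impl Γ (fun g => f₁ g * f₂ g) a (b + 1) :=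
  (sumM (F := fun g _ => f₂ g) h₁ (fun j => h₂.lift (Γ.le_push j f₁)) hle).congr fun g _ => by simp

end Impl

/-! ### Decided predicates: comparisons, connectives and bounded quantifiers -/

namespace ImplP

variable {γ γ' : Type} {Γ : Ctx γ} {Γ' : Ctx γ'} {f f₁ f₂ : γ → ℕ} {p q : γ → Prop} {a b : ℕ}

theorem lift {π : γ' → γ} (hπ : Γ.Le Γ' π) (h : ImplP Γ p a b) :
    ImplP Γ' (fun q => p (π q)) a b :=
  Impl.lift (f := fun g => ind (p g)) hπ h

theorem mono {a' b' : ℕ} (h : ImplP Γ p a b) (ha : a ≤ a') (hb : b ≤ b') : ImplP Γ p a' b' :=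
  Impl.mono h ha hb

theorem congr (h : ImplP Γ p a b) (hp : ∀ g, Γ.D g → (p g ↔ q g)) : ImplP Γ q a b :=
  Impl.congr h fun g hg => ind_congr (hp g hg)

theorem lt (h₁ : Impl Γ f₁ a b) (h₂ : Impl Γ f₂ a b) : ImplP Γ (fun g => f₁ g < f₂ g) a b :=
  -- With truncated subtraction, `1 - (1 - z)` is `0` for `z = 0` and `1` otherwise.
  Impl.map₂ h₁ h₂ (fun i j => .sub (.const 1) (.sub (.const 1) (.sub (.reg j) (.reg i)))) _
    fun g s i j hi hj => by
      simp only [Expr.eval, hi, hj]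
      by_cases h : f₁ g < f₂ g <;> simp only [h, ind_of_true, ind_of_false, not_false_eq_true] <;> omega

theorem eq (h₁ : Impl Γ f₁ a b) (h₂ : Impl Γ f₂ a b) : ImplP Γ (fun g => f₁ g = f₂ g) a b :=
  Impl.map₂ h₁ h₂ (fun i j => .sub (.const 1) (.add (.sub (.reg j) (.reg i)) (.sub (.reg i) (.reg j))))
    _ fun g s i j hi hj => by
      simp only [Expr.eval, hi, hj]
      by_cases h : f₁ g = f₂ g <;> simp only [h, ind_of_true, ind_of_false, not_false_eq_true] <;> omega

theorem not (h : ImplP Γ p a b) : ImplP Γ (fun g => ¬ p g) a b :=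
  Impl.map₁ h (fun i => .sub (.const 1) (.reg i)) _ fun g s i _ _ hi => by
    by_cases h : p g <;> simp [Expr.eval, hi, h]

theorem and (h₁ : ImplP Γ p a b) (h₂ : ImplP Γ q a b) : ImplP Γ (fun g => p g ∧ q g) a b :=
  Impl.map₂ h₁ h₂ (fun i j => .sub (.add (.reg i) (.reg j)) (.const 1)) _ fun g s i j hi hj => by
    by_cases h : p g <;> by_cases h' : q g <;> simp [Expr.eval, hi, hj, h, h']

theorem or (h₁ : ImplP Γ p a b) (h₂ : ImplP Γ q a b) : ImplP Γ (fun g => p g ∨ q g) a b :=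
  (h₁.not.and h₂.not).not.congr fun _ _ => by tauto

theorem imp (h₁ : ImplP Γ p a b) (h₂ : ImplP Γ q a b) : ImplP Γ (fun g => p g → q g) a b :=
  (h₁.and h₂.not).not.congr fun _ _ => by tauto

theorem iff (h₁ : ImplP Γ p a b) (h₂ : ImplP Γ q a b) : ImplP Γ (fun g => p g ↔ q g) a b :=
  ((h₁.imp h₂).and (h₂.imp h₁)).congr fun _ _ => by tauto

theorem ne (h₁ : Impl Γ f₁ a b) (h₂ : Impl Γ f₂ a b) : ImplP Γ (fun g => f₁ g ≠ f₂ g) a b :=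
  (eq h₁ h₂).not

theorem le (h₁ : Impl Γ f₁ a b) (h₂ : Impl Γ f₂ a b) : ImplP Γ (fun g => f₁ g ≤ f₂ g) a b :=
  (lt h₂ h₁).not.congr fun _ _ => not_lt

theorem sum_ind_pos {F : ℕ → Prop} {n : ℕ} :
    0 < ∑ x ∈ Finset.range n, ind (F x) ↔ ∃ x < n, F x := by
  rw [Finset.sum_pos_iff]
  simp only [Finset.mem_range, ind_pos]

/-- All witnesses are counted, without early exit, so a quantifier costs as much as a sum. -/
theorem existsN {c : γ → ℕ} {F : γ → ℕ → Prop} (hc : Impl Γ c (a + 1) b)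
    (hF : ∀ j, ImplP (Γ.push j c) (fun q => F q.1 q.2) a b)
    (hle : ∀ g, Γ.D g → c g ≤ Γ.N g + 1) : ImplP Γ (fun g => ∃ x < c g, F g x) (a + 1) b :=
  (lt (Impl.const 0) (Impl.sumN (F := fun g x => ind (F g x)) hc hF hle)).congr fun _ _ => sum_ind_pos

theorem existsM {c : γ → ℕ} {F : γ → ℕ → Prop} (hc : Impl Γ c a (b + 1))
    (hF : ∀ j, ImplP (Γ.push j c) (fun q => F q.1 q.2) a b)
    (hle : ∀ g, Γ.D g → c g ≤ Γ.M g + 1) : ImplP Γ (fun g => ∃ x < c g, F g x) a (b + 1) :=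
  (lt (Impl.const 0) (Impl.sumM (F := fun g x => ind (F g x)) hc hF hle)).congr fun _ _ => sum_ind_pos

theorem forallN {c : γ → ℕ} {F : γ → ℕ → Prop} (hc : Impl Γ c (a + 1) b)
    (hF : ∀ j, ImplP (Γ.push j c) (fun q => F q.1 q.2) a b)
    (hle : ∀ g, Γ.D g → c g ≤ Γ.N g + 1) : ImplP Γ (fun g => ∀ x < c g, F g x) (a + 1) b :=
  (existsN (F := fun g x => ¬F g x) hc (fun j => (hF j).not) hle).not.congr fun _ _ => by
    push Not; rfl

theorem forallM {c : γ → ℕ} {F : γ → ℕ → Prop} (hc : Impl Γ c a (b + 1))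
    (hF : ∀ j, ImplP (Γ.push j c) (fun q => F q.1 q.2) a b)
    (hle : ∀ g, Γ.D g → c g ≤ Γ.M g + 1) : ImplP Γ (fun g => ∀ x < c g, F g x) a (b + 1) :=
  (existsM (F := fun g x => ¬F g x) hc (fun j => (hF j).not) hle).not.congr fun _ _ => by
    push Not; rfl

end ImplP

/-! ### Straight-line programs that fill arrays -/

namespace Ctx

variable {γ : Type}

/-- The context while a new array is filled: the entries before the current position are there. -/
def pushFill (Γ : Ctx γ) (len : γ → ℕ) (A : γ → ℕ → ℕ) : Ctx (γ × ℕ) where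
  D q := Γ.D q.1 ∧ q.2 < len q.1
  R q s := Γ.R q.1 s ∧ s.reg Γ.k = q.2 ∧ ∀ i < q.2, s.arr Γ.na i = A q.1 i
  k := Γ.k + 2
  na := Γ.na + 1
  N q := Γ.N q.1
  M q := Γ.M q.1
  stable q s s' h hr ha :=
    ⟨Γ.stable _ _ _ h.1 (fun r hk => hr r (by omega)) (fun a hk => ha a (by omega)),
      (hr _ (by omega)).trans h.2.1, fun i hi => by rw [ha _ (by omega), h.2.2 i hi]⟩

/-- The context after a new array has been filled. -/
def addArr (Γ : Ctx γ) (len : γ → ℕ) (A : γ → ℕ → ℕ) : Ctx γ where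
  D := Γ.D
  R g s := Γ.R g s ∧ ∀ i < len g, s.arr Γ.na i = A g i
  k := Γ.k
  na := Γ.na + 1
  N := Γ.N
  M := Γ.M
  stable g s s' h hr ha :=
    ⟨Γ.stable _ _ _ h.1 hr (fun a hk => ha a (by omega)),
      fun i hi => by rw [ha _ (by omega), h.2 i hi]⟩

theorem le_pushFill (Γ : Ctx γ) (len : γ → ℕ) (A : γ → ℕ → ℕ) :
    Γ.Le (Γ.pushFill len A) Prod.fst :=
  ⟨fun _ h => h.1, fun _ _ _ h => h.1, by simp [pushFill], fun _ => rfl, fun _ => rfl⟩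

theorem le_addArr (Γ : Ctx γ) (len : γ → ℕ) (A : γ → ℕ → ℕ) : Γ.Le (Γ.addArr len A) id :=
  ⟨fun _ h => h, fun _ _ _ h => h.1, le_rfl, fun _ => rfl, fun _ => rfl⟩

/-- Recursive tables rest on this: while an entry is computed, all earlier entries of the same array
can be read. -/
theorem hasArr_pushFill (Γ : Ctx γ) (len : γ → ℕ) (A : γ → ℕ → ℕ) :
    (Γ.pushFill len A).HasArr Γ.na (fun q => q.2) (fun q => A q.1) :=
  fun _ _ _ h => h.2.2

theorem hasArr_addArr (Γ : Ctx γ) (len : γ → ℕ) (A : γ → ℕ → ℕ) :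
    (Γ.addArr len A).HasArr Γ.na len A :=
  fun _ _ _ h => h.2

end Ctx

/-- The position that is being filled. -/
theorem Impl.varFill {γ : Type} {Γ : Ctx γ} {len : γ → ℕ} {A : γ → ℕ → ℕ} {a b : ℕ} :
    Impl (Γ.pushFill len A) (fun q => q.2) a b :=
  Impl.reg _ fun _ _ _ h => h.2.1

/-- Some program leads from the initial states to the states that `Γ` describes. -/
def Reach (Γ : Ctx Instance) (a b : ℕ) : Prop :=
  ∃ P C, ∀ I : Instance, ∃ s t, Exec P I.toState s t ∧ t ≤ C * Γ.cost a b I ∧ Γ.D I ∧ Γ.R I s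

/-- One phase of the program: a table is filled from left to right. The exponents `a`, `b` measure
the cost of one entry and `a'`, `b'` the length. The position, the bound and the new value occupy
the registers `k`, `k + 1` and `k + 2`, which are free again afterwards, so only the number of
arrays grows. -/
theorem Reach.fill {Γ : Ctx Instance} {len : Instance → ℕ} {A : Instance → ℕ → ℕ} {a b a' b' : ℕ}
    (h : Reach Γ (a + a') (b + b')) (hlen : Impl Γ len (a + a') (b + b'))
    (hA : Impl (Γ.pushFill len A) (fun q => A q.1 q.2) a b)
    (hle : ∀ I, len I ≤ Γ.cost a' b' I) : Reach (Γ.addArr len A) (a + a') (b + b') := by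
  obtain ⟨P, C, hP⟩ := h
  obtain ⟨Q, C', hQ⟩ := hlen 1
  obtain ⟨B, C'', hB⟩ := hA 0
  set k := Γ.k with hk
  have hkB : (Γ.pushFill len A).k + 0 = k + 2 := rfl
  rw [hkB] at hB
  refine ⟨.seq P (.seq Q (.seq (.assign k (.const 0))
    (.loop k (k + 1) (.seq B (.set Γ.na (.reg k) (.reg (k + 2))))))),
    C + C' + 2 + (C'' + 11) + 4, fun I => ?_⟩
  obtain ⟨s₁, t₁, x₁, x₂, hD, hR⟩ := hP I
  obtain ⟨s₂, t₂, y₁, y₂, y₃, y₄, y₅⟩ := hQ I s₁ hD hR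
  have hR₂ : Γ.R I s₂ := Impl.stable_of_frame hR y₄ y₅
  obtain ⟨s₃, t₃, z₁, z₂, z₃⟩ := Exec.loop (i := k) (b := k + 1) (n := len I)
    (T := C'' * Γ.cost a b I + 3) (P := .seq B (.set Γ.na (.reg k) (.reg (k + 2))))
    (fun x s' => Γ.R I s' ∧ ∀ i < x, s'.arr Γ.na i = A I i) (by omega) (by
      rintro x hx s' ⟨h₁, h₂⟩ hi hb
      obtain ⟨s'', t, w₁, w₂, w₃, w₄, w₅⟩ := hB (I, x) s' ⟨hD, hx⟩ ⟨h₁, hi, h₂⟩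
      refine ⟨_, _, w₁.seq (Exec.set _ _ _ _), add_le_add w₂ le_rfl, ?_, ?_, ?_, ?_⟩
      · exact (w₄ _ (by omega)).trans hi
      · exact (w₄ _ (by omega)).trans hb
      · refine Γ.stable I s' _ h₁ (fun r hr => ?_) (fun c hc => ?_)
        · dsimp only
          rw [Function.update_of_ne (by omega), w₄ _ (by omega)]
        · dsimp only
          rw [Function.update_of_ne (by omega), w₅]
      · intro i hi'
        simp only [Expr.eval, Function.update_self, w₄ k (by omega), hi, w₃]
        by_cases hix : i = x
        · subst hix; simp
        · rw [Function.update_of_ne hix, w₅, h₂ i (by omega)]) (len I) 0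
    { s₂ with reg := Function.update s₂.reg k 0 } (by omega) (by simp)
    (by dsimp only; rw [Function.update_of_ne (by omega), y₃])
    ⟨Γ.stable I s₂ _ hR₂ (fun r hr => by dsimp only; rw [Function.update_of_ne (by omega)])
      (fun _ _ => rfl), by simp⟩
  refine ⟨s₃, _, x₁.seq (y₁.seq ((Exec.assign _ _ _).seq z₁)), ?_, hD, z₃⟩
  have h1 := Γ.one_le_cost a b I
  have h2 := Γ.one_le_cost (a + a') (b + b') I
  have h3 : len I * (C'' * Γ.cost a b I + 3 + 8) ≤ (C'' + 11) * Γ.cost (a + a') (b + b') I := by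
    rw [Γ.cost_add]
    calc len I * (C'' * Γ.cost a b I + 3 + 8)
        ≤ Γ.cost a' b' I * ((C'' + 11) * Γ.cost a b I) := by
          apply Nat.mul_le_mul (hle I)
          rw [add_mul]; omega
      _ = _ := by ring
  have h4 : (Γ.addArr len A).cost (a + a') (b + b') I = Γ.cost (a + a') (b + b') I := rfl
  simp only [Expr.cost, add_mul, h4] at h3 ⊢
  omega

theorem Reach.decide {Γ : Ctx Instance} {p : Instance → Prop} {a b : ℕ} (h : Reach Γ a b)
    (hp : ImplP Γ p a b) : ∃ (P : Program) (C : ℕ), ∀ I : Instance, ∃ s t,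
      Exec P I.toState s t ∧ t ≤ C * Γ.cost a b I ∧ (s.reg 0 = 1 ↔ p I) := by
  obtain ⟨P, C, hP⟩ := h
  obtain ⟨Q, C', hQ⟩ := hp 0
  refine ⟨.seq P (.seq Q (.assign 0 (.reg (Γ.k + 0)))), C + C' + 2, fun I => ?_⟩
  obtain ⟨s₁, t₁, x₁, x₂, hD, hR⟩ := hP I
  obtain ⟨s₂, t₂, y₁, y₂, y₃, -⟩ := hQ I s₁ hD hR
  refine ⟨_, _, x₁.seq (y₁.seq (Exec.assign _ _ _)), ?_, ?_⟩
  · have := Γ.one_le_cost a b I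
    simp only [Expr.cost, add_mul]
    omega
  · simp only [Expr.eval, Function.update_self, y₃]
    by_cases h : p I <;> simp [h]

/-- The context of the initial states. -/
noncomputable def inputCtx (N M : Instance → ℕ) : Ctx Instance where
  D _ := True
  R I s := (∀ i < 3, s.reg i = I.toState.reg i) ∧ ∀ a < 2, s.arr a = I.toState.arr a
  k := 3
  na := 2
  N := N
  M := M
  stable _ _ _ h hr ha :=
    ⟨fun i hi => (hr i hi).trans (h.1 i hi), fun a hi => (ha a hi).trans (h.2 a hi)⟩

theorem Reach.input (N M : Instance → ℕ) (a b : ℕ) : Reach (inputCtx N M) a b :=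
  ⟨.skip, 1, fun I => ⟨_, _, Exec.skip _, by simpa using Ctx.one_le_cost _ _ _ _, trivial,
    fun _ _ => rfl, fun _ _ => rfl⟩⟩

end HappyColoring

namespace HappyColoring

/-! ### The structure of good colorings -/

theorem mk_mem_happyEdges {V C : Type*} {G : SimpleGraph V} {c : V → C} {x y : V} :
    s(x, y) ∈ happyEdges G c ↔ G.Adj x y ∧ c x = c y := by
  refine ⟨fun h => ⟨h.1, h.2 x (by simp) y (by simp)⟩, fun h => ⟨h.1, fun u hu v hv => ?_⟩⟩
  simp only [Sym2.mem_iff] at hu hv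
  rcases hu with rfl | rfl <;> rcases hv with rfl | rfl <;> simp [h.2]

section Structure

variable {V C : Type*} {G : SimpleGraph V} {p : V → Option C} {c : V → C}

open Classical in
/-- Giving color `a` to all vertices in `S` of color `b` does not create more happy edges. -/
theorem IsOptimalForEdges.card_le [Fintype V] {X : Finset V} (hX : IsCliqueModulator G X)
    (hc : IsOptimalForEdges G p c) {a b : C} (hab : a ≠ b)
    (hb : ∃ v, v ∉ X ∧ p v = none ∧ c v = b) :
    (Finset.univ.filter fun v => v ∉ X ∧ c v = a).card ≤
      (Finset.univ.filter fun v => v ∉ X ∧ p v ≠ none ∧ c v = b).card +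
        (X.filter fun v => c v = b).card := by
  set K := Finset.univ.filter fun v => v ∉ X ∧ c v = a with hK
  set N := Finset.univ.filter fun v => v ∉ X ∧ p v ≠ none ∧ c v = b with hN
  set D := X.filter fun v => c v = b with hD
  set B := Finset.univ.filter fun v => v ∉ X ∧ p v = none ∧ c v = b with hB
  have hB0 : 0 < B.card := by
    obtain ⟨v, hv⟩ := hb
    exact Finset.card_pos.2 ⟨v, by simpa [hB] using hv⟩
  let c' : V → C := fun v => if v ∈ B then a else c v
  have hc' : ∀ v, v ∉ B → c' v = c v := fun v hv => by simp [c', hv]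
  have hcB : ∀ v, v ∈ B → c' v = a := fun v hv => by simp [c', hv]
  have hext : Extends p c' := by
    intro v x hv
    rw [hc' v (by simp [hB, hv])]
    exact hc.1 v x hv
  let E := (happyEdges G c).toFinset
  let E' := (happyEdges G c').toFinset
  have hle : E'.card ≤ E.card := by
    have := hc.2 c' hext
    rwa [Set.ncard_eq_toFinset_card', Set.ncard_eq_toFinset_card'] at this
  -- Every pair from `B` and `K` is an edge of the clique; it has the two colors `b` and `a` before
  -- and only `a` afterwards.
  have hgain : B.card * K.card ≤ (E' \ E).card := by
    rw [← Finset.card_product]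
    refine Finset.card_le_card_of_injOn (fun q => s(q.1, q.2)) ?_ ?_
    · rintro ⟨x, y⟩ hxy
      simp only [Finset.coe_product, Set.mem_prod, Finset.mem_coe] at hxy
      obtain ⟨hx, hy⟩ := hxy
      have hx' := hx
      have hy' := hy
      simp only [hB, hK, Finset.mem_filter, Finset.mem_univ, true_and] at hx' hy'
      have hyB : y ∉ B := by simp [hB, hy'.2, hab]
      have hne : x ≠ y := fun h => hyB (h ▸ hx)
      have hadj : G.Adj x y := hX hx'.1 hy'.1 hne
      simp only [E', E, Finset.coe_sdiff, Set.coe_toFinset, Set.mem_sdiff, mk_mem_happyEdges, hadj,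
        true_and, hcB x hx, hc' y hyB, hy'.2, hx'.2.2]
      exact hab.symm
    · rintro ⟨x, y⟩ hxy ⟨x', y'⟩ hxy' h
      simp only [Finset.coe_product, Set.mem_prod, Finset.mem_coe, hB, hK, Finset.mem_filter,
        Finset.mem_univ, true_and] at hxy hxy'
      simp only [Sym2.eq_iff] at h
      rcases h with ⟨rfl, rfl⟩ | ⟨rfl, rfl⟩
      · rfl
      · exact absurd (hxy'.2.2.symm.trans hxy.1.2.2) hab
  -- An edge that stops being happy has exactly one end in `B`. The other end has color `b` and was
  -- not recolored, so it is either precolored and outside `X`, or in `X`.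
  have hloss : (E \ E').card ≤ B.card * (N.card + D.card) := by
    calc (E \ E').card ≤ ((B ×ˢ (N ∪ D)).image fun q => s(q.1, q.2)).card := by
          apply Finset.card_le_card
          intro e
          induction e with | _ x y
          simp only [E', E, Finset.mem_sdiff, Set.mem_toFinset, mk_mem_happyEdges]
          rintro ⟨⟨hadj, hxy⟩, h'⟩
          have hn : c' x ≠ c' y := fun h => h' ⟨hadj, h⟩
          have key : ∀ z w, z ∈ B → w ∉ B → c z = c w → w ∈ N ∪ D := by
            intro z w hz hw hzw
            simp only [hB, hN, hD, Finset.mem_filter, Finset.mem_univ, true_and,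
              Finset.mem_union] at hz hw ⊢
            rw [hz.2.2] at hzw
            by_cases hwX : w ∈ X
            · exact Or.inr ⟨hwX, hzw.symm⟩
            · exact Or.inl ⟨hwX, fun h => hw ⟨hwX, h, hzw.symm⟩, hzw.symm⟩
          simp only [Finset.mem_image, Finset.mem_product]
          by_cases hx : x ∈ B <;> by_cases hy : y ∈ B
          · exact absurd ((hcB x hx).trans (hcB y hy).symm) hn
          · exact ⟨(x, y), ⟨hx, key x y hx hy hxy⟩, rfl⟩
          · exact ⟨(y, x), ⟨hy, key y x hy hx hxy.symm⟩, Sym2.eq_swap⟩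
          · exact absurd (by rw [hc' x hx, hc' y hy, hxy]) hn
      _ ≤ B.card * (N.card + D.card) := by
          refine Finset.card_image_le.trans ?_
          rw [Finset.card_product]
          exact Nat.mul_le_mul_left _ (Finset.card_union_le _ _)
  -- Optimality, after cancelling the edges that are happy in both colorings.
  have hsd : (E' \ E).card ≤ (E \ E').card := by
    have h1 := Finset.card_sdiff_add_card_inter E E'
    have h2 := Finset.card_sdiff_add_card_inter E' E
    rw [Finset.inter_comm] at h2
    omega
  exact Nat.le_of_mul_le_mul_left (hgain.trans (hsd.trans hloss)) hB0

open Classical in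
/-- If more vertices of the clique are uncolored than there are vertices outside the clique, then
optimal colorings for edges are constant on them. -/
theorem IsOptimalForEdges.eq_of_card_lt [Fintype V] {X : Finset V} (hX : IsCliqueModulator G X)
    (hc : IsOptimalForEdges G p c)
    (hlt : X.card < {v | v ∉ X ∧ p v = none}.ncard)
    {v w : V} (hv : v ∉ X ∧ p v = none) (hw : w ∉ X ∧ p w = none) : c v = c w := by
  by_contra hvw
  set U := Finset.univ.filter fun v => v ∉ X ∧ p v = none with hU
  have hUc : {v | v ∉ X ∧ p v = none} = (U : Set V) := by
    ext v
    simp [hU]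
  rw [hUc, Set.ncard_coe_finset] at hlt
  set S := U.image c with hS
  let k : C → ℕ := fun a => (Finset.univ.filter fun v => v ∉ X ∧ c v = a).card
  let n : C → ℕ := fun a => (Finset.univ.filter fun v => v ∉ X ∧ p v ≠ none ∧ c v = a).card
  let u : C → ℕ := fun a => (U.filter fun v => c v = a).card
  let d : C → ℕ := fun a => (X.filter fun v => c v = a).card
  have hk : ∀ a, k a = n a + u a := by
    intro a
    simp only [k, n, u]
    rw [← Finset.card_union_of_disjoint]
    · congr 1
      ext v
      simp only [hU, Finset.mem_filter, Finset.mem_univ, true_and, Finset.mem_union]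
      tauto
    · rw [Finset.disjoint_left]
      intro v h1 h2
      simp only [hU, Finset.mem_filter, Finset.mem_univ, true_and] at h1 h2
      exact h1.2.1 h2.1.2
  have hmv : ∀ a b, a ≠ b → b ∈ S → k a ≤ n b + d b := by
    intro a b hab hb
    obtain ⟨x, hx, rfl⟩ := Finset.mem_image.1 hb
    simp only [hU, Finset.mem_filter, Finset.mem_univ, true_and] at hx
    exact hc.card_le hX hab ⟨x, hx.1, hx.2, rfl⟩
  have hvS : c v ∈ S := Finset.mem_image_of_mem c (by simpa [hU] using hv)
  have hwS : c w ∈ S := Finset.mem_image_of_mem c (by simpa [hU] using hw)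
  obtain ⟨a, haS, ha⟩ := S.exists_max_image k ⟨_, hvS⟩
  obtain ⟨b, hbS, hba⟩ : ∃ b ∈ S, b ≠ a := by
    by_cases h : c v = a
    · exact ⟨c w, hwS, fun h' => hvw (h.trans h'.symm)⟩
    · exact ⟨c v, hvS, h⟩
  -- For `x ≠ a`, maximality of `k a` gives `n x + u x = k x ≤ k a ≤ n x + d x`, hence `u x ≤ d x`.
  -- The color `a` alone allows no such conclusion, so it is paired with `b`: adding `k a ≤ n b + d
  -- b` and `k b ≤ n a + d a` gives `u a + u b ≤ d a + d b`.
  have hsum : ∑ x ∈ S, u x ≤ ∑ x ∈ S, d x := by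
    have hbS' : b ∈ S.erase a := Finset.mem_erase.2 ⟨hba, hbS⟩
    rw [← Finset.add_sum_erase _ u haS, ← Finset.add_sum_erase _ u hbS',
      ← Finset.add_sum_erase _ d haS, ← Finset.add_sum_erase _ d hbS']
    have h1 : ∑ x ∈ (S.erase a).erase b, u x ≤ ∑ x ∈ (S.erase a).erase b, d x := by
      apply Finset.sum_le_sum
      intro x hx
      simp only [Finset.mem_erase] at hx
      have h1 := hmv a x hx.2.1.symm hx.2.2
      have h2 := ha x hx.2.2
      have h3 := hk x
      omega
    have h2 := hmv a b hba.symm hbS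
    have h3 := hmv b a hba haS
    have h4 := hk a
    have h5 := hk b
    omega
  have hu : U.card = ∑ x ∈ S, u x :=
    Finset.card_eq_sum_card_fiberwise fun x hx => Finset.mem_image_of_mem c hx
  have hd : ∑ x ∈ S, d x ≤ X.card := by
    simp only [d]
    rw [← Finset.card_biUnion]
    · exact Finset.card_le_card (Finset.biUnion_subset.2 fun x _ => Finset.filter_subset _ _)
    · intro x _ y _ hxy
      simp only [Function.onFun, Finset.disjoint_left, Finset.mem_filter]
      rintro z ⟨_, rfl⟩ ⟨_, h⟩
      exact hxy h
  omega

theorem exists_isOptimalForEdges [Finite V] [Finite C] (hc : Extends p c) :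
    ∃ c', IsOptimalForEdges G p c' ∧ (happyEdges G c).ncard ≤ (happyEdges G c').ncard := by
  obtain ⟨c', h, h'⟩ := Set.exists_max_image {c : V → C | Extends p c}
    (fun c => (happyEdges G c).ncard) (Set.toFinite _) ⟨c, hc⟩
  exact ⟨c', ⟨h, h'⟩, h' c hc⟩

/-- Uncolored vertices of the clique with the same neighbors outside of it may be assumed to have
the same color. -/
theorem happyVertices_subset_of_representatives {X : Finset V} (hX : IsCliqueModulator G X)
    (r : V → V) (hr : ∀ v, r v = v ∨ (v ∉ X ∧ r v ∉ X ∧ ∀ x ∈ X, G.Adj v x ↔ G.Adj (r v) x)) :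
    happyVertices G c ⊆ happyVertices G (fun v => c (r v)) := by
  intro h hh w hw
  simp only [happyVertices, Set.mem_ofPred_eq] at hh ⊢
  -- The representative of a vertex in the closed neighborhood of `h` lies in that neighborhood
  -- again: for `h` in `X` because both vertices have the same neighbors in `X`, and for `h` outside
  -- `X` because of the clique. So all the new colors there equal the old color of `h`.
  have key : ∀ z, (z = h ∨ G.Adj h z) → c (r z) = c h := by
    intro z hz
    rcases hr z with h1 | ⟨h1, h2, h3⟩
    · rw [h1]
      rcases hz with rfl | hz
      · rfl
      · exact hh z hz
    · by_cases hhX : h ∈ X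
      · rcases hz with rfl | hz
        · exact absurd hhX h1
        · exact hh _ ((h3 h hhX).1 hz.symm).symm
      · by_cases he : r z = h
        · rw [he]
        · exact hh _ (hX hhX h2 (Ne.symm he))
  rw [key w (Or.inr hw), key h (Or.inl rfl)]

end Structure
end HappyColoring

namespace HappyColoring

/-! ### The last number with a property -/

open Classical in
/-- One plus the last number below `n` with the property `P`, and `0` if there is none. -/
noncomputable def lastSat (P : ℕ → Prop) (n : ℕ) : ℕ :=
  Nat.rec 0 (fun x v => if P x then x + 1 else v) n

section lastSat

variable {P Q : ℕ → Prop} {n x : ℕ}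

open Classical in
theorem lastSat_succ (P : ℕ → Prop) (n : ℕ) :
    lastSat P (n + 1) = if P n then n + 1 else lastSat P n := rfl

theorem lastSat_spec (h : lastSat P n = x + 1) : x < n ∧ P x := by
  induction n with
  | zero => simp [lastSat] at h
  | succ n ih =>
    rw [lastSat_succ] at h
    split_ifs at h with hn
    · obtain rfl : n = x := by omega
      exact ⟨by omega, hn⟩
    · exact ⟨(ih h).1.trans (by omega), (ih h).2⟩

theorem lt_lastSat (hx : x < n) (h : P x) : x < lastSat P n := by
  induction n with
  | zero => omega
  | succ n ih =>
    rw [lastSat_succ]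
    split_ifs with hn
    · exact hx
    · refine ih (lt_of_le_of_ne (by omega) ?_)
      rintro rfl
      exact hn h

theorem not_of_lastSat_eq_zero (h : lastSat P n = 0) (hx : x < n) : ¬P x := by
  intro hP
  have := lt_lastSat hx hP
  omega

theorem lastSat_congr (h : ∀ x < n, P x ↔ Q x) : lastSat P n = lastSat Q n := by
  induction n with
  | zero => rfl
  | succ n ih =>
    have hn := h n (by omega)
    rw [lastSat_succ, lastSat_succ, ih fun x hx => h x (by omega)]
    by_cases hQ : Q n <;> simp [hn, hQ]

end lastSat

theorem ind_eq_ite {p : Prop} [Decidable p] : ind p = if p then 1 else 0 := by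
  by_cases h : p <;> simp [h]

theorem sum_ind (n : ℕ) (P : ℕ → Prop) [DecidablePred P] :
    ∑ x ∈ Finset.range n, ind (P x) = ((Finset.range n).filter P).card := by
  rw [Finset.card_filter]
  refine Finset.sum_congr rfl fun x _ => ?_
  by_cases h : P x <;> simp [h]

namespace Instance

variable (I : Instance)

/-! ### Colorings with natural numbers -/

/-- Adjacency of vertices that are given as numbers. -/
def adj (u v : ℕ) : Prop := ∃ (hu : u < I.n) (hv : v < I.n), I.G.Adj ⟨u, hu⟩ ⟨v, hv⟩

/-- The precoloring with colors from `1` to `l`, where `0` means not precolored. -/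
noncomputable def pc (v : ℕ) : ℕ := I.toState.arr 1 v

theorem pc_eq {v : ℕ} (h : v < I.n) :
    I.pc v = match I.p ⟨v, h⟩ with
      | none => 0
      | some j => j.val + 1 := by
  simp only [pc, toState, h, dif_pos]
  rfl

theorem pc_eq_zero {v : ℕ} (h : v < I.n) : I.pc v = 0 ↔ I.p ⟨v, h⟩ = none := by
  rw [I.pc_eq h]
  cases I.p ⟨v, h⟩ <;> simp

theorem pc_of_some {v : ℕ} (h : v < I.n) {j : Fin I.l} (hj : I.p ⟨v, h⟩ = some j) :
    I.pc v = j.val + 1 := by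
  rw [I.pc_eq h, hj]

theorem pc_le (v : ℕ) : I.pc v ≤ I.l := by
  by_cases h : v < I.n
  · rw [I.pc_eq h]
    cases I.p ⟨v, h⟩ with
    | none => exact Nat.zero_le _
    | some j => exact j.2
  · simp [pc, toState, h]

/-- The two problems: edges for `true` and vertices for `false`. -/
def problem : Bool → Instance → Prop
  | true => MaxHappyEdges
  | false => MaxHappyVertices

/-- The number of happy edges or happy vertices inside a set of vertices. -/
noncomputable def classValue (S : ℕ → Prop) : Bool → ℕ
  | true => ∑ v ∈ Finset.range I.n, ∑ u ∈ Finset.range I.n,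
      ind ((u < v ∧ I.adj v u) ∧ S v ∧ S u)
  | false => ∑ v ∈ Finset.range I.n, ind (S v ∧ ∀ u < I.n, I.adj v u → S u)

/-- The number of happy edges or happy vertices of a coloring. -/
noncomputable def value (C : ℕ → ℕ) : Bool → ℕ
  | true => ∑ v ∈ Finset.range I.n, ∑ u ∈ Finset.range I.n, ind ((u < v ∧ I.adj v u) ∧ C v = C u)
  | false => ∑ v ∈ Finset.range I.n, ind (∀ u < I.n, I.adj v u → C v = C u)

theorem classValue_mono {S T : ℕ → Prop} (h : ∀ v < I.n, S v → T v) (e : Bool) :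
    I.classValue S e ≤ I.classValue T e := by
  cases e
  · refine Finset.sum_le_sum fun v hv => ind_mono ?_
    rw [Finset.mem_range] at hv
    exact fun hS => ⟨h v hv hS.1, fun u hu huv => h u hu (hS.2 u hu huv)⟩
  · refine Finset.sum_le_sum fun v hv => Finset.sum_le_sum fun u hu => ind_mono ?_
    rw [Finset.mem_range] at hu hv
    exact fun hS => ⟨hS.1, h v hv hS.2.1, h u hu hS.2.2⟩

theorem value_congr {C C' : ℕ → ℕ} (h : ∀ v < I.n, ∀ u < I.n, C v = C u ↔ C' v = C' u) (e : Bool) :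
    I.value C e = I.value C' e := by
  cases e
  · refine Finset.sum_congr rfl fun v hv => ind_congr ?_
    rw [Finset.mem_range] at hv
    exact forall₂_congr fun u hu => by rw [h v hv u hu]
  · refine Finset.sum_congr rfl fun v hv => Finset.sum_congr rfl fun u hu => ind_congr ?_
    rw [Finset.mem_range] at hu hv
    rw [h v hv u hu]

/-- The value of a coloring is the sum of the values of its classes. -/
theorem sum_classValue {J : Finset ℕ} {col : ℕ → ℕ} {C : ℕ → ℕ}
    (h : ∀ v < I.n, ∃ j ∈ J, col j ≠ 0 ∧ C v = col j)
    (hcol : ∀ i ∈ J, ∀ j ∈ J, col i ≠ 0 → col i = col j → i = j) (e : Bool) :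
    ∑ j ∈ J, (if col j = 0 then 0 else I.classValue (fun v => C v = col j) e) = I.value C e := by
  -- Exactly one index carries the color of `v`, so a property of `v` is counted once over all
  -- classes. Indices with `col j = 0` are dummies.
  have key : ∀ v < I.n, ∀ Q : Prop,
      ∑ j ∈ J, (if col j = 0 then 0 else ind (C v = col j ∧ Q)) = ind Q := by
    intro v hv Q
    obtain ⟨i, hi, h0, hCi⟩ := h v hv
    rw [Finset.sum_eq_single_of_mem i hi]
    · rw [if_neg h0]
      exact ind_congr (by simp [hCi])
    · intro j hj hji
      split_ifs with hj0
      · rfl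
      · exact ind_of_false fun hC => hji (hcol j hj i hi hj0 (hC.1.symm.trans hCi))
  cases e
  · calc _ = ∑ j ∈ J, ∑ v ∈ Finset.range I.n, (if col j = 0 then 0 else
          ind (C v = col j ∧ ∀ u < I.n, I.adj v u → C v = C u)) := by
          refine Finset.sum_congr rfl fun j _ => ?_
          split_ifs with h0
          · simp
          · refine Finset.sum_congr rfl fun v _ => ind_congr ?_
            refine and_congr_right fun hv => forall₃_congr fun u _ _ => ?_
            rw [hv]
            exact eq_comm
      _ = _ := by
          rw [Finset.sum_comm]
          exact Finset.sum_congr rfl fun v hv => key v (Finset.mem_range.1 hv) _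
  · calc _ = ∑ j ∈ J, ∑ v ∈ Finset.range I.n, ∑ u ∈ Finset.range I.n, (if col j = 0 then 0 else
          ind (C v = col j ∧ (u < v ∧ I.adj v u) ∧ C v = C u)) := by
          refine Finset.sum_congr rfl fun j _ => ?_
          split_ifs with h0
          · simp
          · refine Finset.sum_congr rfl fun v _ => Finset.sum_congr rfl fun u _ => ind_congr ?_
            constructor
            · rintro ⟨h1, h2, h3⟩
              exact ⟨h2, h1, h2.trans h3.symm⟩
            · rintro ⟨h1, h2, h3⟩
              exact ⟨h2, h1, h3.symm.trans h1⟩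
      _ = _ := by
          rw [Finset.sum_comm]
          refine Finset.sum_congr rfl fun v hv => ?_
          rw [Finset.sum_comm]
          exact Finset.sum_congr rfl fun u _ => key v (Finset.mem_range.1 hv) _

/-- A coloring of the vertices with `1, …, l` that extends the precoloring. -/
def Valid (C : ℕ → ℕ) : Prop :=
  ∀ v < I.n, C v ≠ 0 ∧ C v ≤ I.l ∧ (I.pc v ≠ 0 → C v = I.pc v)

/-- A coloring as a function on natural numbers. -/
def code (c : Fin I.n → Fin I.l) (v : ℕ) : ℕ := if h : v < I.n then (c ⟨v, h⟩).val + 1 else 0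

theorem code_of_lt (c : Fin I.n → Fin I.l) {v : ℕ} (h : v < I.n) :
    I.code c v = (c ⟨v, h⟩).val + 1 := by simp [code, h]

theorem code_val (c : Fin I.n → Fin I.l) (v : Fin I.n) : I.code c v = (c v).val + 1 :=
  I.code_of_lt c v.2

theorem code_eq_iff (c : Fin I.n → Fin I.l) (u v : Fin I.n) :
    I.code c u = I.code c v ↔ c u = c v := by
  simp [code_val, Fin.ext_iff]

theorem adj_val (u v : Fin I.n) : I.adj u v ↔ I.G.Adj u v := by simp [adj]

theorem valid_code {c : Fin I.n → Fin I.l} (hc : Extends I.p c) : I.Valid (I.code c) := by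
  intro v hv
  rw [I.code_of_lt c hv]
  refine ⟨by omega, (c ⟨v, hv⟩).2, fun h => ?_⟩
  cases hp : I.p ⟨v, hv⟩ with
  | none => exact absurd ((I.pc_eq_zero hv).2 hp) h
  | some j => rw [I.pc_of_some hv hp, hc _ _ hp]

theorem exists_code {C : ℕ → ℕ} (hC : I.Valid C) :
    ∃ c : Fin I.n → Fin I.l, Extends I.p c ∧ ∀ v < I.n, I.code c v = C v := by
  refine ⟨fun v => ⟨C v - 1, ?_⟩, ?_, ?_⟩
  · have := hC v v.2
    omega
  · intro v a hv
    have h := hC v v.2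
    have h' := I.pc_of_some v.2 hv
    ext
    simp only
    rw [h.2.2 (by omega), h']
    rfl
  · intro v hv
    rw [I.code_of_lt _ hv]
    have := hC v hv
    simp only
    omega

theorem value_code_false (c : Fin I.n → Fin I.l) :
    I.value (I.code c) false = (happyVertices I.G c).ncard := by
  classical
  rw [value, Finset.sum_range, Set.ncard_eq_toFinset_card']
  have : (happyVertices I.G c).toFinset = Finset.univ.filter
      fun v : Fin I.n => ∀ u < I.n, I.adj v u → I.code c v = I.code c u := by
    ext v
    rw [Set.mem_toFinset, Finset.mem_filter]
    simp only [happyVertices, Set.mem_ofPred_eq, Finset.mem_univ, true_and]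
    constructor
    · intro h u hu huv
      exact (I.code_eq_iff c v ⟨u, hu⟩).2 (h ⟨u, hu⟩ ((I.adj_val _ _).1 huv)).symm
    · intro h u huv
      exact ((I.code_eq_iff c v u).1 (h u u.2 ((I.adj_val _ _).2 huv))).symm
  rw [this, Finset.card_filter]
  exact Finset.sum_congr rfl fun v _ => ind_eq_ite

theorem value_code_true (c : Fin I.n → Fin I.l) :
    I.value (I.code c) true = (happyEdges I.G c).ncard := by
  classical
  let A : Finset (Fin I.n × Fin I.n) :=
    Finset.univ.filter fun q => (q.2 < q.1 ∧ I.G.Adj q.1 q.2) ∧ c q.1 = c q.2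
  have hA : happyEdges I.G c = (fun q : Fin I.n × Fin I.n => s(q.1, q.2)) '' A := by
    ext e
    induction e with | _ x y
    simp only [mk_mem_happyEdges, A, Finset.coe_filter, Finset.mem_univ, true_and, Set.mem_image,
      Set.mem_ofPred_eq, Prod.exists]
    constructor
    · rintro ⟨h, h'⟩
      rcases lt_or_gt_of_ne h.ne with hxy | hxy
      · exact ⟨y, x, ⟨⟨hxy, h.symm⟩, h'.symm⟩, Sym2.eq_swap⟩
      · exact ⟨x, y, ⟨⟨hxy, h⟩, h'⟩, rfl⟩
    · rintro ⟨u, v, ⟨⟨h1, h2⟩, h3⟩, h⟩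
      simp only [Sym2.eq_iff] at h
      rcases h with ⟨rfl, rfl⟩ | ⟨rfl, rfl⟩
      · exact ⟨h2, h3⟩
      · exact ⟨h2.symm, h3.symm⟩
  rw [hA, Set.InjOn.ncard_image, Set.ncard_coe_finset, Finset.card_filter, value,
    Finset.sum_range, Fintype.sum_prod_type]
  · refine Finset.sum_congr rfl fun v _ => ?_
    rw [Finset.sum_range]
    refine Finset.sum_congr rfl fun u _ => ?_
    rw [ind_eq_ite]
    simp only [I.adj_val, I.code_eq_iff, Fin.lt_def]
  · rintro ⟨x, y⟩ h ⟨x', y'⟩ h' hxy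
    simp only [A, Finset.coe_filter, Finset.mem_univ, true_and, Set.mem_ofPred_eq] at h h'
    simp only [Sym2.eq_iff] at hxy
    rcases hxy with ⟨rfl, rfl⟩ | ⟨rfl, rfl⟩
    · rfl
    · exact absurd h.1.1 (not_lt.2 h'.1.1.le)

theorem problem_iff (e : Bool) : problem e I ↔ ∃ C, I.Valid C ∧ I.k ≤ I.value C e := by
  have h1 : problem e I ↔
      ∃ c : Fin I.n → Fin I.l, Extends I.p c ∧ I.k ≤ I.value (I.code c) e := by
    cases e
    · simp only [value_code_false]; rfl
    · simp only [value_code_true]; rfl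
  rw [h1]
  constructor
  · rintro ⟨c, hc, h⟩
    exact ⟨_, I.valid_code hc, h⟩
  · rintro ⟨C, hC, h⟩
    obtain ⟨c, hc, hcC⟩ := I.exists_code hC
    refine ⟨c, hc, ?_⟩
    rwa [I.value_congr fun v hv u hu => by rw [hcC v hv, hcC u hu]]

/-! ### A clique modulator -/

/-- A greedy maximal matching in the complement of the graph: `mate v` is `u + 1` if `v` is matched
with a smaller vertex `u`, and `0` otherwise. -/
noncomputable def mate (v : ℕ) : ℕ :=
  lastSat (fun u => (∃ _ : u < v, mate u = 0) ∧ (∀ w, (_ : w < v) → mate w ≠ u + 1) ∧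
    ¬I.adj u v) v
  termination_by v

/-- The proof of `u < v` inside the definition only serves termination; the search for the last `u`
is restricted to `u < v` anyway. -/
theorem mate_eq (v : ℕ) : I.mate v =
    lastSat (fun u => I.mate u = 0 ∧ (∀ w < v, I.mate w ≠ u + 1) ∧ ¬I.adj u v) v := by
  rw [mate]
  exact lastSat_congr fun x hx => by simp [hx]

theorem mate_spec {u v : ℕ} (h : I.mate v = u + 1) :
    u < v ∧ I.mate u = 0 ∧ (∀ w < v, I.mate w ≠ u + 1) ∧ ¬I.adj u v := by
  rw [mate_eq] at h
  exact lastSat_spec h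

theorem mate_inj {u v w : ℕ} (hv : I.mate v = u + 1) (hw : I.mate w = u + 1) : v = w := by
  rcases lt_trichotomy v w with h | h | h
  · exact absurd hv ((I.mate_spec hw).2.2.1 v h)
  · exact h
  · exact absurd hw ((I.mate_spec hv).2.2.1 w h)

/-- The matched vertices. -/
def inMod (v : ℕ) : Prop := I.mate v ≠ 0 ∨ ∃ w < I.n, I.mate w = v + 1

/-- Maximality of the matching: if `u` and `v` were unmatched and not adjacent, `u` would be an
admissible partner when `v` is processed, and `v` would get some partner. -/
theorem adj_of_not_inMod {u v : ℕ} (huv : u < v) (hv : v < I.n) (h1 : ¬I.inMod u)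
    (h2 : ¬I.inMod v) : I.adj u v := by
  by_contra h
  have h0 : I.mate v = 0 := by
    by_contra h0
    exact h2 (Or.inl h0)
  have hu0 : I.mate u = 0 := by
    by_contra h0
    exact h1 (Or.inl h0)
  rw [mate_eq] at h0
  exact not_of_lastSat_eq_zero h0 huv
    ⟨hu0, fun w hw hwu => h1 (Or.inr ⟨w, hw.trans hv, hwu⟩), h⟩

open Classical in
/-- The modulator that consists of the matched vertices. -/
noncomputable def modulator : Finset (Fin I.n) := Finset.univ.filter fun v => I.inMod v

theorem mem_modulator (v : Fin I.n) : v ∈ I.modulator ↔ I.inMod v := by simp [modulator]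

theorem isCliqueModulator_modulator : IsCliqueModulator I.G I.modulator := by
  intro u hu v hv huv
  simp only [Set.mem_ofPred_eq, mem_modulator] at hu hv
  rcases lt_or_gt_of_ne huv with h | h
  · exact (I.adj_val _ _).1 (I.adj_of_not_inMod h v.2 hu hv)
  · exact ((I.adj_val _ _).1 (I.adj_of_not_inMod h u.2 hv hu)).symm

/-- The matched vertices are at most twice as many as those of any clique modulator. -/
theorem card_modulator_le {X : Finset (Fin I.n)} (hX : IsCliqueModulator I.G X) :
    I.modulator.card ≤ 2 * X.card := by
  classical
  let T : Finset (Fin I.n) := Finset.univ.filter fun v => I.mate v ≠ 0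
  have hT : ∀ v ∈ T, ∃ u : Fin I.n, I.mate v = u + 1 := by
    intro v hv
    obtain ⟨u, hu⟩ := Nat.exists_eq_succ_of_ne_zero (Finset.mem_filter.1 hv).2
    exact ⟨⟨u, (I.mate_spec hu).1.trans v.2⟩, hu⟩
  have : ∀ v : Fin I.n, ∃ u : Fin I.n, v ∈ T → I.mate v = u + 1 := by
    intro v
    by_cases hv : v ∈ T
    · obtain ⟨u, hu⟩ := hT v hv
      exact ⟨u, fun _ => hu⟩
    · exact ⟨v, fun h => absurd h hv⟩
  choose r hr using this
  have hrT : ∀ v ∈ T, r v ∉ T := fun v hv h =>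
    (Finset.mem_filter.1 h).2 (I.mate_spec (hr v hv)).2.1
  have hrinj : ∀ v ∈ T, ∀ w ∈ T, r v = r w → v = w := by
    intro v hv w hw h
    refine Fin.ext (I.mate_inj (hr v hv) ?_)
    rw [h]
    exact hr w hw
  -- Each matched pair is a non-edge, so one of its ends lies in `X`. The pairs are disjoint, so
  -- choosing such an end is injective.
  have hTX : T.card ≤ X.card := by
    refine Finset.card_le_card_of_injOn (fun v => if v ∈ X then v else r v) ?_ ?_
    · intro v hv
      simp only [Finset.mem_coe] at hv ⊢
      split_ifs with h
      · exact h
      · by_contra hrX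
        have hs := I.mate_spec (hr v hv)
        refine hs.2.2.2 ((I.adj_val _ _).2 (hX hrX h ?_))
        exact fun h => hs.1.ne (congrArg Fin.val h)
    · intro v hv w hw h
      simp only [Finset.mem_coe] at hv hw h
      split_ifs at h with h1 h2 h2
      · exact h
      · exact absurd (h ▸ hv) (hrT w hw)
      · exact absurd (h ▸ hw) (hrT v hv)
      · exact hrinj v hv w hw h
  have hsub : I.modulator ⊆ T ∪ T.image r := by
    intro v hv
    rw [mem_modulator] at hv
    rw [Finset.mem_union, Finset.mem_image]
    rcases hv with hv | ⟨w, hw, hwv⟩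
    · exact Or.inl (Finset.mem_filter.2 ⟨Finset.mem_univ _, hv⟩)
    · have hwT : (⟨w, hw⟩ : Fin I.n) ∈ T := Finset.mem_filter.2 ⟨Finset.mem_univ _, by simp [hwv]⟩
      refine Or.inr ⟨_, hwT, Fin.ext ?_⟩
      have := hr _ hwT
      simp only at this
      omega
  calc I.modulator.card ≤ T.card + (T.image r).card :=
        (Finset.card_le_card hsub).trans (Finset.card_union_le _ _)
    _ ≤ T.card + T.card := Nat.add_le_add_left Finset.card_image_le _
    _ ≤ 2 * X.card := by omega

/-! ### Groups of vertices that get the same color -/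

/-- Whether vertices of the clique are put into the same group. -/
def Twin (u v : ℕ) : Bool → Prop
  | true => ∑ x ∈ Finset.range I.n, ind (I.inMod x) <
      ∑ x ∈ Finset.range I.n, ind (I.pc x = 0 ∧ ¬I.inMod x)
  | false => ∀ x < I.n, I.inMod x → (I.adj u x ↔ I.adj v x)

/-- Whether uncolored vertices are in the same group. -/
def Eqv (e : Bool) (u v : ℕ) : Prop := u = v ∨ (¬I.inMod u ∧ ¬I.inMod v) ∧ I.Twin u v e

variable {I} {e : Bool} {u v w : ℕ}

theorem Eqv.symm (h : I.Eqv e u v) : I.Eqv e v u := by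
  rcases h with rfl | ⟨⟨h1, h2⟩, h3⟩
  · exact Or.inl rfl
  · refine Or.inr ⟨⟨h2, h1⟩, ?_⟩
    cases e
    · exact fun x hx hm => (h3 x hx hm).symm
    · exact h3

theorem Eqv.trans (h : I.Eqv e u v) (h' : I.Eqv e v w) : I.Eqv e u w := by
  rcases h with rfl | ⟨⟨h1, h2⟩, h3⟩
  · exact h'
  rcases h' with rfl | ⟨⟨h1', h2'⟩, h3'⟩
  · exact Or.inr ⟨⟨h1, h2⟩, h3⟩
  · refine Or.inr ⟨⟨h1, h2'⟩, ?_⟩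
    cases e
    · exact fun x hx hm => (h3 x hx hm).trans (h3' x hx hm)
    · exact h3

variable (I)

/-- One plus the last uncolored vertex in the group of `v`. -/
noncomputable def root (e : Bool) (v : ℕ) : ℕ := lastSat (fun u => I.pc u = 0 ∧ I.Eqv e u v) I.n

variable {I}

theorem exists_root (hv : v < I.n) (h0 : I.pc v = 0) :
    ∃ u < I.n, I.root e v = u + 1 ∧ I.pc u = 0 ∧ I.Eqv e u v := by
  have h := lt_lastSat (P := fun u => I.pc u = 0 ∧ I.Eqv e u v) hv ⟨h0, Or.inl rfl⟩
  obtain ⟨u, hu⟩ := Nat.exists_eq_succ_of_ne_zero (Nat.ne_zero_of_lt h)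
  have hs := lastSat_spec hu
  exact ⟨u, hs.1, hu, hs.2⟩

theorem root_eq_of_eqv (h : I.Eqv e u v) : I.root e u = I.root e v :=
  lastSat_congr fun _ _ => and_congr_right fun _ => ⟨fun h' => h'.trans h, fun h' => h'.trans h.symm⟩

theorem eqv_of_root_eq (hu : u < I.n) (h0 : I.pc u = 0) (hv : v < I.n) (h0' : I.pc v = 0)
    (h : I.root e u = I.root e v) : I.Eqv e u v := by
  obtain ⟨x, -, hx, -, hxu⟩ := exists_root (e := e) hu h0
  obtain ⟨y, -, hy, -, hyv⟩ := exists_root (e := e) hv h0'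
  obtain rfl : x = y := by omega
  exact hxu.symm.trans hyv

variable (I)

/-- The representatives of the groups. -/
def IsRep (e : Bool) (u : ℕ) : Prop := I.pc u = 0 ∧ I.root e u = u + 1

/-- The number of groups. -/
noncomputable def items (e : Bool) : ℕ := ∑ u ∈ Finset.range I.n, ind (I.IsRep e u)

/-- The number of a group. -/
noncomputable def idx (e : Bool) (v : ℕ) : ℕ :=
  ∑ u ∈ Finset.range I.n, ind (I.IsRep e u ∧ u + 1 < I.root e v)

variable {I}

theorem isRep_of_root (hv : v < I.n) (h0 : I.pc v = 0) (h : I.root e v = u + 1) :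
    u < I.n ∧ I.IsRep e u := by
  obtain ⟨x, hxn, hx, hx0, hxv⟩ := exists_root (e := e) hv h0
  obtain rfl : x = u := by omega
  exact ⟨hxn, hx0, (root_eq_of_eqv hxv).trans hx⟩

/-- The number of a group is the rank of its representative among all representatives. The
representative itself is not counted, which makes the inequality strict. -/
theorem idx_lt_items (hv : v < I.n) (h0 : I.pc v = 0) : I.idx e v < I.items e := by
  obtain ⟨x, hxn, hx, -⟩ := exists_root (e := e) hv h0
  refine Finset.sum_lt_sum (fun u _ => ind_mono And.left) ⟨x, Finset.mem_range.2 hxn, ?_⟩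
  rw [ind_of_false (by omega), ind_of_true (isRep_of_root hv h0 hx).2]
  exact Nat.one_pos

theorem idx_lt_idx (hu : u < I.n) (h0 : I.pc u = 0) (h : I.root e u < I.root e v) :
    I.idx e u < I.idx e v := by
  obtain ⟨x, hxn, hx, -⟩ := exists_root (e := e) hu h0
  refine Finset.sum_lt_sum (fun y _ => ind_mono fun hy => ⟨hy.1, hy.2.trans h⟩)
    ⟨x, Finset.mem_range.2 hxn, ?_⟩
  rw [ind_of_false (by omega), ind_of_true ⟨(isRep_of_root hu h0 hx).2, by omega⟩]
  exact Nat.one_pos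

theorem eqv_of_idx_eq (hu : u < I.n) (h0 : I.pc u = 0) (hv : v < I.n) (h0' : I.pc v = 0)
    (h : I.idx e u = I.idx e v) : I.Eqv e u v := by
  refine eqv_of_root_eq hu h0 hv h0' ?_
  rcases lt_trichotomy (I.root e u) (I.root e v) with h' | h' | h'
  · exact absurd h (idx_lt_idx hu h0 h').ne
  · exact h'
  · exact absurd h (idx_lt_idx hv h0' h').ne'

end Instance
end HappyColoring

namespace HappyColoring
namespace Instance

/-! ### Reduction to colorings that are constant on the groups -/

variable (I : Instance)

theorem sum_ind_fin (P : ℕ → Prop) [DecidablePred fun v : Fin I.n => P v] :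
    ∑ x ∈ Finset.range I.n, ind (P x) =
      (Finset.univ.filter fun v : Fin I.n => P v).card := by
  rw [Finset.sum_range, Finset.card_filter]
  exact Finset.sum_congr rfl fun v _ => ind_eq_ite

theorem sum_inMod : ∑ x ∈ Finset.range I.n, ind (I.inMod x) = I.modulator.card := by
  classical
  rw [I.sum_ind_fin, modulator]

/-- Vertices in the same group may be assumed to have the same color. -/
theorem problem_iff_eqv (e : Bool) : problem e I ↔ ∃ C, I.Valid C ∧
    (∀ u < I.n, I.pc u = 0 → ∀ v < I.n, I.pc v = 0 → I.Eqv e u v → C u = C v) ∧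
    I.k ≤ I.value C e := by
  classical
  refine ⟨?_, fun ⟨C, h, _, h'⟩ => (I.problem_iff e).2 ⟨C, h, h'⟩⟩
  have hX := I.isCliqueModulator_modulator
  cases e
  · rintro ⟨c, hc, hk⟩
    -- For vertices, an uncolored vertex copies the color of the representative of its group, and a
    -- precolored vertex represents itself.
    have : ∀ v : Fin I.n, ∃ w : Fin I.n, (I.pc v = 0 → I.root false v = w + 1 ∧ I.pc w = 0 ∧
        I.Eqv false w v) ∧ (I.pc v ≠ 0 → w = v) := by
      intro v
      by_cases h0 : I.pc v = 0
      · obtain ⟨u, hu, h⟩ := exists_root (e := false) v.2 h0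
        exact ⟨⟨u, hu⟩, fun _ => h, fun h => absurd h0 h⟩
      · exact ⟨v, fun h => absurd h h0, fun _ => rfl⟩
    choose r hr hr' using this
    have hext : Extends I.p (fun v => c (r v)) := by
      intro v a hv
      simp only
      rw [hr' v (by simp [I.pc_of_some v.2 hv])]
      exact hc v a hv
    refine ⟨I.code fun v => c (r v), I.valid_code hext, ?_, ?_⟩
    · intro u hu hu0 v hv hv0 huv
      refine (I.code_eq_iff _ ⟨u, hu⟩ ⟨v, hv⟩).2 (congrArg c (Fin.ext ?_))
      have h1 := (hr ⟨u, hu⟩ hu0).1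
      have h2 := (hr ⟨v, hv⟩ hv0).1
      have h3 := root_eq_of_eqv huv
      simp only at h1 h2
      omega
    · rw [value_code_false]
      refine hk.trans (Set.ncard_le_ncard ?_ (Set.toFinite _))
      refine happyVertices_subset_of_representatives hX r fun v => ?_
      by_cases h0 : I.pc v = 0
      · rcases (hr v h0).2.2 with h | ⟨⟨h1, h2⟩, h3⟩
        · exact Or.inl (Fin.ext h)
        · refine Or.inr ⟨fun h => h2 ((I.mem_modulator _).1 h),
            fun h => h1 ((I.mem_modulator _).1 h), fun x hx => ?_⟩
          rw [← I.adj_val, ← I.adj_val]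
          exact (h3 x x.2 ((I.mem_modulator _).1 hx)).symm
      · exact Or.inl (hr' v h0)
  · rintro ⟨c, hc, hk⟩
    -- For edges, an optimal coloring is already constant on the groups: a nontrivial group exists
    -- only if the uncolored vertices outside the modulator outnumber the modulator.
    obtain ⟨c', hc', hle⟩ := exists_isOptimalForEdges (G := I.G) hc
    refine ⟨I.code c', I.valid_code hc'.1, ?_, ?_⟩
    · rintro u hu hu0 v hv hv0 (rfl | ⟨⟨h1, h2⟩, h3⟩)
      · rfl
      refine (I.code_eq_iff _ ⟨u, hu⟩ ⟨v, hv⟩).2 (hc'.eq_of_card_lt hX ?_ ?_ ?_)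
      · have h3' : _ < _ := h3
        rw [sum_inMod, I.sum_ind_fin fun x => I.pc x = 0 ∧ ¬I.inMod x] at h3'
        refine h3'.trans_le ?_
        rw [← Set.ncard_coe_finset]
        refine Set.ncard_le_ncard (fun x hx => ?_) (Set.toFinite _)
        rw [Finset.mem_coe, Finset.mem_filter] at hx
        exact ⟨fun h => hx.2.2 ((I.mem_modulator x).1 h), (I.pc_eq_zero x.2).1 hx.2.1⟩
      · exact ⟨fun h => h1 ((I.mem_modulator _).1 h), (I.pc_eq_zero hu).1 hu0⟩
      · exact ⟨fun h => h2 ((I.mem_modulator _).1 h), (I.pc_eq_zero hv).1 hv0⟩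
    · rw [value_code_true]
      exact hk.trans hle

/-! ### The number of groups -/

variable {I} in
theorem IsRep.eq_of_eqv {e : Bool} {u v : ℕ} (hu : I.IsRep e u) (hv : I.IsRep e v)
    (h : I.Eqv e u v) : u = v := by
  have := root_eq_of_eqv h
  rw [hu.2, hv.2] at this
  omega

open Classical in
theorem items_le (e : Bool) : I.items e ≤ I.modulator.card +
    ((Finset.range I.n).filter fun u => I.IsRep e u ∧ ¬I.inMod u).card := by
  rw [← sum_inMod, ← sum_ind, ← Finset.sum_add_distrib]
  refine Finset.sum_le_sum fun u _ => ?_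
  by_cases h1 : I.IsRep e u <;> by_cases h2 : I.inMod u <;> simp [h1, h2]

/-- For edges, `Twin` does not depend on the two vertices. Either all uncolored vertices outside the
modulator form one group, or there are at most as many of them as there are vertices in the
modulator. -/
theorem items_true_le : I.items true ≤ 2 * I.modulator.card + 1 := by
  classical
  refine (I.items_le true).trans ?_
  rw [two_mul, add_assoc]
  refine Nat.add_le_add_left ?_ _
  by_cases h : I.Twin 0 0 true
  · refine le_trans (Finset.card_le_one.2 fun u hu v hv => ?_) (Nat.le_add_left 1 _)
    rw [Finset.mem_filter] at hu hv
    exact hu.2.1.eq_of_eqv hv.2.1 (Or.inr ⟨⟨hu.2.2, hv.2.2⟩, h⟩)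
  · simp only [Twin, not_lt, sum_inMod] at h
    refine le_trans ?_ (h.trans (Nat.le_succ _))
    rw [← sum_ind]
    exact Finset.sum_le_sum fun u _ => ind_mono fun hu => ⟨hu.1.1, hu.2⟩

/-- A group outside the modulator is determined by its neighborhood in the modulator. -/
theorem items_false_le : I.items false ≤ I.modulator.card + 2 ^ I.modulator.card := by
  classical
  refine (I.items_le false).trans (Nat.add_le_add_left ?_ _)
  rw [← Finset.card_powerset]
  refine Finset.card_le_card_of_injOn (fun u => I.modulator.filter fun x => I.adj u x)
    (fun u _ => Finset.mem_coe.2 (Finset.mem_powerset.2 (Finset.filter_subset _ _))) ?_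
  intro u hu v hv huv
  rw [Finset.mem_coe, Finset.mem_filter] at hu hv
  refine hu.2.1.eq_of_eqv hv.2.1 (Or.inr ⟨⟨hu.2.2, hv.2.2⟩, fun x hx hm => ?_⟩)
  have := Finset.ext_iff.1 huv ⟨x, hx⟩
  simpa [mem_modulator, hm] using this

/-! ### Candidates for colors -/

open Classical in
/-- The colors of the precolored vertices, followed by the first `n` colors. -/
noncomputable def rawCol (j : ℕ) : ℕ :=
  if j < I.n then I.pc j else if j + 1 ≤ I.l + I.n then j + 1 - I.n else 0

open Classical in
/-- The candidates for colors without repetitions. -/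
noncomputable def col (j : ℕ) : ℕ := if ∃ i < j, I.rawCol i = I.rawCol j then 0 else I.rawCol j

theorem rawCol_le (j : ℕ) : I.rawCol j ≤ I.l := by
  unfold rawCol
  split_ifs
  · exact I.pc_le j
  · omega
  · omega

theorem col_le (j : ℕ) : I.col j ≤ I.l := by
  unfold col
  split_ifs
  · omega
  · exact I.rawCol_le j

theorem col_inj {i j : ℕ} (hi : I.col i ≠ 0) (h : I.col i = I.col j) : i = j := by
  have hi' : ¬(∃ x < i, I.rawCol x = I.rawCol i) ∧ I.col i = I.rawCol i := by
    unfold col at hi ⊢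
    split_ifs at hi ⊢ with h'
    · exact absurd rfl hi
    · exact ⟨h', rfl⟩
  rw [h] at hi
  have hj' : ¬(∃ x < j, I.rawCol x = I.rawCol j) ∧ I.col j = I.rawCol j := by
    unfold col at hi ⊢
    split_ifs at hi ⊢ with h'
    · exact absurd rfl hi
    · exact ⟨h', rfl⟩
  have he : I.rawCol i = I.rawCol j := by rw [← hi'.2, ← hj'.2, h]
  rcases lt_trichotomy i j with hij | hij | hij
  · exact absurd ⟨i, hij, he⟩ hj'.1
  · exact hij
  · exact absurd ⟨j, hij, he.symm⟩ hi'.1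

theorem exists_col_eq (j : ℕ) : ∃ i ≤ j, I.col i = I.rawCol j := by
  induction j using Nat.strong_induction_on with
  | _ j ih =>
    by_cases h : ∃ i < j, I.rawCol i = I.rawCol j
    · obtain ⟨i, hi, hij⟩ := h
      obtain ⟨x, hx, h'⟩ := ih i hi
      exact ⟨x, by omega, h'.trans hij⟩
    · exact ⟨j, le_rfl, by simp only [col, h, if_false]⟩

theorem exists_col_eq_pc {v : ℕ} (hv : v < I.n) : ∃ i < 2 * I.n, I.col i = I.pc v := by
  obtain ⟨i, hi, h⟩ := I.exists_col_eq v
  exact ⟨i, by omega, by simpa [rawCol, hv] using h⟩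

theorem exists_col_eq_of_le {a : ℕ} (h0 : a ≠ 0) (hn : a ≤ I.n) (hl : a ≤ I.l) :
    ∃ i < 2 * I.n, I.col i = a := by
  obtain ⟨i, hi, h⟩ := I.exists_col_eq (I.n + a - 1)
  refine ⟨i, by omega, ?_⟩
  rw [h, rawCol, if_neg (by omega), if_pos (by omega)]
  omega

/-- The colors may be assumed to be among the candidates. -/
theorem exists_rename {C : ℕ → ℕ} (hC : I.Valid C) : ∃ σ : ℕ → ℕ,
    (∀ u < I.n, ∀ v < I.n, C u = C v ↔ σ (C u) = σ (C v)) ∧ I.Valid (fun v => σ (C v)) ∧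
    ∀ v < I.n, ∃ j < 2 * I.n, I.col j = σ (C v) := by
  classical
  let U := (Finset.range I.n).image C
  let D := Finset.Icc 1 (min I.l I.n)
  let P := (Finset.range I.n).image I.pc
  let B := (U \ D) \ P
  -- `B` consists of the colors in use that are neither precolors nor among the first `min l n`
  -- colors `D`. At most `min l n` colors are in use, so `D` has enough unused colors to rename `B`
  -- injectively; precolored vertices are not affected.
  have hU : U.card ≤ D.card := by
    have h1 : U.card ≤ I.n := Finset.card_image_le.trans (by simp)
    have h2 : U.card ≤ I.l := by
      have : U ⊆ Finset.Icc 1 I.l := by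
        intro x hx
        obtain ⟨v, hv, rfl⟩ := Finset.mem_image.1 hx
        have := hC v (Finset.mem_range.1 hv)
        exact Finset.mem_Icc.2 ⟨by omega, this.2.1⟩
      simpa using Finset.card_le_card this
    simp only [D, Nat.card_Icc]
    omega
  have hBD : B.card ≤ (D \ U).card := by
    have h1 : B.card ≤ (U \ D).card := Finset.card_le_card Finset.sdiff_subset
    have h2 := Finset.card_sdiff_add_card_inter U D
    have h3 := Finset.card_sdiff_add_card_inter D U
    rw [Finset.inter_comm] at h3
    omega
  obtain ⟨f⟩ : Nonempty (B ↪ (D \ U : Finset ℕ)) :=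
    Function.Embedding.nonempty_of_card_le (by simpa using hBD)
  let σ : ℕ → ℕ := fun x => if h : x ∈ B then (f ⟨x, h⟩ : ℕ) else x
  have hσB : ∀ x (h : x ∈ B), σ x = f ⟨x, h⟩ := fun x h => by simp [σ, h]
  have hσ : ∀ x, x ∉ B → σ x = x := fun x h => by simp [σ, h]
  have hfm : ∀ x (h : x ∈ B), σ x ∈ D ∧ σ x ∉ U := by
    intro x h
    rw [hσB x h]
    exact Finset.mem_sdiff.1 (f ⟨x, h⟩).2
  have hCU : ∀ v < I.n, C v ∈ U := fun v hv =>
    Finset.mem_image_of_mem C (Finset.mem_range.2 hv)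
  refine ⟨σ, fun u hu v hv => ⟨fun h => by rw [h], fun h => ?_⟩, ?_, ?_⟩
  · by_cases h1 : C u ∈ B <;> by_cases h2 : C v ∈ B
    · rw [hσB _ h1, hσB _ h2] at h
      simpa using f.injective (Subtype.ext h)
    · rw [hσ _ h2] at h
      exact absurd (h ▸ hCU v hv) (hfm _ h1).2
    · rw [hσ _ h1] at h
      exact absurd (h ▸ hCU u hu) (hfm _ h2).2
    · rwa [hσ _ h1, hσ _ h2] at h
  · intro v hv
    by_cases h : C v ∈ B
    · have hD := Finset.mem_Icc.1 (hfm _ h).1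
      refine ⟨by simp only; omega, by simp only; omega, fun h0 => ?_⟩
      have hP : C v ∈ P := by
        rw [(hC v hv).2.2 h0]
        exact Finset.mem_image_of_mem _ (Finset.mem_range.2 hv)
      exact absurd hP (Finset.mem_sdiff.1 h).2
    · simp only [hσ _ h]
      exact hC v hv
  · intro v hv
    by_cases h : C v ∈ B
    · have hD := Finset.mem_Icc.1 (hfm _ h).1
      exact I.exists_col_eq_of_le (by omega) (by omega) (by omega)
    · rw [hσ _ h]
      by_cases hP : C v ∈ P
      · obtain ⟨w, hw, hwv⟩ := Finset.mem_image.1 hP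
        rw [← hwv]
        exact I.exists_col_eq_pc (Finset.mem_range.1 hw)
      · have hD : C v ∈ D := by
          by_contra hD
          exact h (Finset.mem_sdiff.2 ⟨Finset.mem_sdiff.2 ⟨hCU v hv, hD⟩, hP⟩)
        have := Finset.mem_Icc.1 hD
        exact I.exists_col_eq_of_le (by omega) (by omega) (by omega)

/-! ### Dynamic programming over the colors -/

open Classical in
/-- The value of the class with the candidate `j` for the color and with the groups in the bit
mask `m`. -/
noncomputable def layer (e : Bool) (j m : ℕ) : ℕ :=
  if I.col j = 0 then 0 else
    I.classValue (fun v => I.pc v = I.col j ∨ (I.pc v = 0 ∧ m.testBit (I.idx e v) = true)) e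

/-- The bit mask `m` contains `m₁` and `m₂`, which are disjoint. -/
def Split (e : Bool) (m m₁ m₂ : ℕ) : Prop :=
  ∀ b < I.items e, (m₁.testBit b = true → m.testBit b = true ∧ ¬m₂.testBit b = true) ∧
    (m₂.testBit b = true → m.testBit b = true)

open Classical in
/-- The largest total value of classes with the first `j` candidates for colors, where groups from
the bit mask `m` may be used. -/
noncomputable def opt (e : Bool) : ℕ → ℕ → ℕ
  | 0, _ => 0
  | j + 1, m => (Finset.range (2 ^ I.items e)).sup fun m₁ =>
      (Finset.range (2 ^ I.items e)).sup fun m₂ =>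
        if I.Split e m m₁ m₂ then opt e j m₁ + I.layer e j m₂ else 0

variable {I} {e : Bool}

open Classical in
/-- The total value of the first `j` classes if group `b` gets the candidate `o b`. -/
noncomputable def ownerValue (I : Instance) (e : Bool) (q : ℕ → Prop) (o : ℕ → ℕ) (j : ℕ) : ℕ :=
  ∑ i ∈ Finset.range j, if I.col i = 0 then 0 else
    I.classValue (fun v => I.pc v = I.col i ∨
      (I.pc v = 0 ∧ q (I.idx e v) ∧ o (I.idx e v) = i)) e

/-- Soundness of the table: every entry is bounded by the value of an actual assignment of groups to
candidates. The groups in the last mask get the candidate `j`, and the others keep their candidate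
from the previous row. The case `j = 0` is exceptional as there are no candidates. -/
theorem exists_owner (j m : ℕ) : ∃ o : ℕ → ℕ, (∀ b, o b < j ∨ j = 0) ∧
    I.opt e j m ≤ ownerValue I e (fun b => m.testBit b = true) o j := by
  induction j generalizing m with
  | zero => exact ⟨fun _ => 0, fun _ => Or.inr rfl, Nat.zero_le _⟩
  | succ j ih =>
    have h0 : ∃ o : ℕ → ℕ, (∀ b, o b < j + 1 ∨ j + 1 = 0) ∧
        0 ≤ ownerValue I e (fun b => m.testBit b = true) o (j + 1) :=
      ⟨fun _ => 0, fun _ => Or.inl (Nat.succ_pos _), Nat.zero_le _⟩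
    have hmax : ∀ x y : ℕ,
        (∃ o : ℕ → ℕ, (∀ b, o b < j + 1 ∨ j + 1 = 0) ∧
          x ≤ ownerValue I e (fun b => m.testBit b = true) o (j + 1)) →
        (∃ o : ℕ → ℕ, (∀ b, o b < j + 1 ∨ j + 1 = 0) ∧
          y ≤ ownerValue I e (fun b => m.testBit b = true) o (j + 1)) →
        ∃ o : ℕ → ℕ, (∀ b, o b < j + 1 ∨ j + 1 = 0) ∧
          x ⊔ y ≤ ownerValue I e (fun b => m.testBit b = true) o (j + 1) := by
      intro x y hx hy
      rcases le_total x y with h | h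
      · rwa [sup_eq_right.2 h]
      · rwa [sup_eq_left.2 h]
    rw [opt]
    -- Being bounded by the value of some assignment holds for `0` and passes to maxima, so it
    -- suffices to treat single masks.
    refine Finset.sup_induction h0 (fun x hx y hy => hmax x y hx hy) fun m₁ _ => ?_
    refine Finset.sup_induction h0 (fun x hx y hy => hmax x y hx hy) fun m₂ _ => ?_
    by_cases hs : I.Split e m m₁ m₂
    swap
    · rw [if_neg hs]
      exact h0
    rw [if_pos hs]
    obtain ⟨o, ho, hle⟩ := ih m₁
    -- The default `0` is for `j = 0`, where nothing is known about `o b`; it keeps the candidate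
    -- below `j + 1`.
    refine ⟨fun b => if m₂.testBit b = true then j else if o b < j then o b else 0, fun b => ?_, ?_⟩
    · left
      dsimp only
      split_ifs <;> omega
    · rw [ownerValue, Finset.sum_range_succ]
      refine add_le_add (hle.trans (Finset.sum_le_sum fun i hi => ?_)) ?_
      · rw [Finset.mem_range] at hi
        split_ifs with hc
        · exact le_rfl
        · refine I.classValue_mono (fun v hv => Or.imp_right ?_) e
          rintro ⟨hv0, hb, hoi⟩
          have hs' := (hs _ (idx_lt_items hv hv0)).1 hb
          refine ⟨hv0, hs'.1, ?_⟩
          rw [if_neg hs'.2, if_pos (by omega), hoi]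
      · rw [layer]
        split_ifs with hc
        · exact le_rfl
        · refine I.classValue_mono (fun v hv => Or.imp_right ?_) e
          rintro ⟨hv0, hb⟩
          exact ⟨hv0, (hs _ (idx_lt_items hv hv0)).2 hb, if_pos hb⟩

theorem exists_mask (t : ℕ) (q : ℕ → Prop) : ∃ m < 2 ^ t, ∀ b < t, m.testBit b = true ↔ q b := by
  induction t with
  | zero => exact ⟨0, by simp, by simp⟩
  | succ t ih =>
    obtain ⟨m, hm, h⟩ := ih
    by_cases ht : q t
    · refine ⟨2 ^ t + m, by rw [pow_succ]; omega, fun b hb => ?_⟩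
      rcases Nat.lt_succ_iff_lt_or_eq.1 hb with hb | rfl
      · rw [Nat.testBit_two_pow_add_gt hb]
        exact h b hb
      · rw [Nat.testBit_two_pow_add_eq, Nat.testBit_lt_two_pow hm]
        simpa using ht
    · refine ⟨m, by rw [pow_succ]; omega, fun b hb => ?_⟩
      rcases Nat.lt_succ_iff_lt_or_eq.1 hb with hb | rfl
      · exact h b hb
      · rw [Nat.testBit_lt_two_pow hm]
        simpa using ht

/-- Completeness of the table: an assignment competes in the maximum, with the groups of candidate
less than `j` as `m₁` and those of candidate equal to `j` as `m₂`. -/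
theorem ownerValue_le (o : ℕ → ℕ) (j m : ℕ)
    (hm : ∀ b < I.items e, m.testBit b = true ↔ o b < j) :
    ownerValue I e (fun _ => True) o j ≤ I.opt e j m := by
  classical
  induction j generalizing m with
  | zero => simp [ownerValue]
  | succ j ih =>
    obtain ⟨m₁, hm₁, h₁⟩ := exists_mask (I.items e) fun b => o b < j
    obtain ⟨m₂, hm₂, h₂⟩ := exists_mask (I.items e) fun b => o b = j
    have hs : I.Split e m m₁ m₂ := by
      intro b hb
      rw [hm b hb, h₁ b hb, h₂ b hb]
      omega
    rw [opt]
    refine le_trans ?_ (Finset.le_sup (f := fun m₁ => (Finset.range (2 ^ I.items e)).sup fun m₂ =>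
      if I.Split e m m₁ m₂ then I.opt e j m₁ + I.layer e j m₂ else 0) (Finset.mem_range.2 hm₁))
    refine le_trans ?_ (Finset.le_sup (f := fun m₂ =>
      if I.Split e m m₁ m₂ then I.opt e j m₁ + I.layer e j m₂ else 0) (Finset.mem_range.2 hm₂))
    rw [if_pos hs, ownerValue, Finset.sum_range_succ]
    refine add_le_add (ih m₁ h₁) ?_
    rw [layer]
    split_ifs
    · exact le_rfl
    · refine I.classValue_mono (fun v hv => Or.imp_right ?_) e
      rintro ⟨hv0, -, hb⟩
      exact ⟨hv0, (h₂ _ (idx_lt_items hv hv0)).2 hb⟩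

variable (I) (e)

/-- The answer of the algorithm is correct. -/
theorem problem_iff_opt :
    problem e I ↔ 0 < I.l ∧ ∃ m < 2 ^ I.items e, I.k ≤ I.opt e (2 * I.n) m := by
  classical
  constructor
  · intro h
    obtain ⟨C₀, hC₀, heq₀, hk⟩ := (I.problem_iff_eqv e).1 h
    obtain ⟨σ, hσ, hC, hcol⟩ := I.exists_rename hC₀
    rw [I.value_congr hσ] at hk
    set C : ℕ → ℕ := fun v => σ (C₀ v)
    -- Without vertices the value would be `0`, but `k` is positive.
    have hn : 0 < I.n := by
      by_contra hn
      have h1 := I.k_pos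
      have h2 : I.value C e = 0 := by
        obtain h0 : I.n = 0 := by omega
        cases e <;> simp [value, h0]
      omega
    refine ⟨by have := hC 0 hn; omega, ?_⟩
    -- The coloring is constant on each group, so one candidate serves all its vertices.
    have ho : ∀ b : ℕ, ∃ j, ∀ v < I.n, I.pc v = 0 → I.idx e v = b →
        j < 2 * I.n ∧ I.col j = C v := by
      intro b
      by_cases hb : ∃ v < I.n, I.pc v = 0 ∧ I.idx e v = b
      · obtain ⟨v, hv, hv0, hvb⟩ := hb
        obtain ⟨j, hj, hjv⟩ := hcol v hv
        refine ⟨j, fun w hw hw0 hwb => ⟨hj, ?_⟩⟩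
        rw [hjv]
        exact congrArg σ (heq₀ v hv hv0 w hw hw0
          (eqv_of_idx_eq hv hv0 hw hw0 (hvb.trans hwb.symm)))
      · exact ⟨0, fun v hv hv0 hvb => absurd ⟨v, hv, hv0, hvb⟩ hb⟩
    choose o ho using ho
    obtain ⟨m, hm, hmb⟩ := exists_mask (I.items e) fun b => o b < 2 * I.n
    refine ⟨m, hm, hk.trans (le_trans ?_ (ownerValue_le o (2 * I.n) m hmb))⟩
    rw [← I.sum_classValue (J := Finset.range (2 * I.n)) (col := I.col) (C := C)]
    · refine Finset.sum_le_sum fun i hi => ?_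
      split_ifs with hc
      · exact le_rfl
      · refine I.classValue_mono (fun v hv hvi => ?_) e
        by_cases hv0 : I.pc v = 0
        · refine Or.inr ⟨hv0, trivial, ?_⟩
          have := (ho _ v hv hv0 rfl).2
          exact (I.col_inj hc (hvi.symm.trans this.symm)).symm
        · exact Or.inl ((hC v hv).2.2 hv0 ▸ hvi)
    · intro v hv
      obtain ⟨j, hj, hjv⟩ := hcol v hv
      refine ⟨j, Finset.mem_range.2 hj, ?_, hjv.symm⟩
      rw [hjv]
      exact (hC v hv).1
    · exact fun i _ j _ hi hij => I.col_inj hi hij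
  · rintro ⟨hl, m, -, hk⟩
    obtain ⟨o, ho, hle⟩ := exists_owner (I := I) (e := e) (2 * I.n) m
    -- Groups that are not used, or whose candidate is a dummy, get the color `1`. This only
    -- enlarges the classes, and the class values are monotone.
    let C : ℕ → ℕ := fun v => if I.pc v ≠ 0 then I.pc v else
      if m.testBit (I.idx e v) = true ∧ I.col (o (I.idx e v)) ≠ 0 then I.col (o (I.idx e v)) else 1
    refine (I.problem_iff e).2 ⟨C, ?_, hk.trans (hle.trans ?_)⟩
    · intro v _
      simp only [C]
      split_ifs with h1 h2
      · exact ⟨h1, I.pc_le v, fun _ => rfl⟩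
      · exact ⟨h2.2, I.col_le _, fun h => absurd h h1⟩
      · exact ⟨one_ne_zero, hl, fun h => absurd h h1⟩
    · rw [← I.sum_classValue (J := Finset.range (2 * I.n)) (col := I.col) (C := C)]
      · refine Finset.sum_le_sum fun i hi => ?_
        split_ifs with hc
        · exact le_rfl
        · refine I.classValue_mono (fun v hv hvi => ?_) e
          rcases hvi with h | ⟨h0, hb, rfl⟩
          · simp only [C]
            rw [if_pos (h ▸ hc), h]
          · simp only [C]
            rw [if_neg (by simpa using h0), if_pos ⟨hb, hc⟩]
      · intro v hv
        simp only [Finset.mem_range, C]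
        split_ifs with h1 h2
        · obtain ⟨j, hj, h⟩ := I.exists_col_eq_pc hv
          exact ⟨j, hj, h ▸ h1, h.symm⟩
        · exact ⟨_, (ho _).resolve_right (by omega), h2.2, rfl⟩
        · obtain ⟨j, hj, h⟩ := I.exists_col_eq_of_le one_ne_zero (by omega) hl
          exact ⟨j, hj, by omega, h.symm⟩
      · exact fun i _ j _ hi hij => I.col_inj hi hij

end Instance
end HappyColoring

namespace HappyColoring
open Instance

/-! ### The program -/

theorem Ctx.Le.of_addArr {γ : Type} {Γ : Ctx Instance} {Γ' : Ctx γ} {π : γ → Instance}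
    {len : Instance → ℕ} {A : Instance → ℕ → ℕ} (h : (Γ.addArr len A).Le Γ' π) : Γ.Le Γ' π :=
  ⟨h.D, fun q s hD hR => (h.R q s hD hR).1, h.k, h.N, h.M⟩

theorem Ctx.Le.get {γ : Type} {Γ : Ctx Instance} {Γ' : Ctx γ} {π : γ → Instance}
    {len : Instance → ℕ} {A : Instance → ℕ → ℕ} (h : (Γ.addArr len A).Le Γ' π) {f : γ → ℕ}
    {a b : ℕ} (hf : Impl Γ' f a b) (hlt : ∀ g, Γ'.D g → f g < len (π g)) :
    Impl Γ' (fun g => A (π g) (f g)) a b :=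
  Impl.get (Ctx.HasArr.lift h (Γ.hasArr_addArr len A)) hf hlt

/-- Searching for the last rather than the first number needs no early exit: each hit overwrites the
accumulator. -/
theorem Impl.lastN {γ : Type} {Γ : Ctx γ} {c : γ → ℕ} {F : γ → ℕ → Prop} {a b : ℕ}
    (hc : Impl Γ c (a + 1) b) (hF : ∀ j, ImplP (Γ.push j c) (fun q => F q.1 q.2) a b)
    (hle : ∀ g, Γ.D g → c g ≤ Γ.N g + 1) :
    Impl Γ (fun g => lastSat (F g) (c g)) (a + 1) b := by
  classical
  exact Impl.foldN (body := fun g x v => if F g x then x + 1 else v) hc (.const 0)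
    (fun j => .ite ((hF j).lift (Γ.le_pushAcc j c))
      (.add (Impl.var.lift (Γ.le_pushAcc j c)) (.const 1)) (.reg (Γ.k + j) fun _ _ _ h => h.2)) hle

theorem Instance.arr_adj (I : Instance) {u v : ℕ} (hu : u < I.n) (hv : v < I.n) :
    I.toState.arr 0 (u * I.n + v) = ind (I.adj u v) := by
  classical
  have : (∃ x y : Fin I.n, I.G.Adj x y ∧ u * I.n + v = x.val * I.n + y.val) ↔ I.adj u v := by
    constructor
    · rintro ⟨x, y, h, hxy⟩
      have h0 : 0 < I.n := by omega
      have h1 : u = x := by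
        have h2 : ∀ a b : ℕ, b < I.n → (a * I.n + b) / I.n = a := fun a b hb => by
          rw [add_comm, Nat.add_mul_div_right _ _ h0, Nat.div_eq_of_lt hb, zero_add]
        rw [← h2 u v hv, hxy, h2 _ _ y.2]
      have h2 : v = y := by
        rw [h1] at hxy
        omega
      subst h1 h2
      exact (I.adj_val x y).2 h
    · rintro ⟨_, _, h⟩
      exact ⟨_, _, h, rfl⟩
  rw [← ind_congr this]
  simp only [toState, if_true]
  exact ind_eq_ite.symm

section

variable (e : Bool)

/-- The context at the beginning. -/
noncomputable def ctxInput : Ctx Instance := inputCtx (fun I => 2 * I.n) (fun I => 2 ^ I.items e)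

/-- The context with the matching. -/
noncomputable def ctxMate : Ctx Instance := (ctxInput e).addArr (fun I => I.n) (fun I => I.mate)

/-- The context with the modulator. -/
noncomputable def ctxMod : Ctx Instance :=
  (ctxMate e).addArr (fun I => I.n) (fun I v => ind (I.inMod v))

/-- The context with the representatives of the groups. -/
noncomputable def ctxRoot : Ctx Instance :=
  (ctxMod e).addArr (fun I => I.n) (fun I => I.root e)

/-- The context with the numbers of the groups. -/
noncomputable def ctxIdx : Ctx Instance := (ctxRoot e).addArr (fun I => I.n) (fun I => I.idx e)

/-- The context with the number of groups. -/
noncomputable def ctxItems : Ctx Instance := (ctxIdx e).addArr (fun _ => 1) (fun I _ => I.items e)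

/-- The context with the number of bit masks. -/
noncomputable def ctxPow : Ctx Instance :=
  (ctxItems e).addArr (fun _ => 1) (fun I _ => 2 ^ I.items e)

/-- The context with the candidates for colors. -/
noncomputable def ctxCol : Ctx Instance := (ctxPow e).addArr (fun I => 2 * I.n) (fun I => I.col)

/-- The context with the table of the dynamic program. -/
noncomputable def ctxOpt : Ctx Instance :=
  (ctxCol e).addArr (fun I => (2 * I.n + 1) * 2 ^ I.items e)
    (fun I i => I.opt e (i / 2 ^ I.items e) (i % 2 ^ I.items e))

end

/-! ### Subroutines: access to the input and computation of the tables -/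

section

variable {e : Bool} {γ : Type} {Γ : Ctx γ} {π : γ → Instance} {a b : ℕ} {u v : γ → ℕ}

theorem Ctx.Le.n_le (h : (ctxInput e).Le Γ π) (g : γ) (_ : Γ.D g) : (π g).n ≤ Γ.N g + 1 := by
  rw [h.N]
  simp only [ctxInput, inputCtx]
  omega

theorem Ctx.Le.pow_le (h : (ctxInput e).Le Γ π) (g : γ) (_ : Γ.D g) :
    2 ^ (π g).items e ≤ Γ.M g + 1 := by
  rw [h.M]
  simp only [ctxInput, inputCtx]
  omega

theorem Ctx.Le.items_le (h : (ctxInput e).Le Γ π) (g : γ) (hg : Γ.D g) :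
    (π g).items e ≤ Γ.M g + 1 :=
  Nat.lt_two_pow_self.le.trans (h.pow_le g hg)

theorem Impl.n (h : (ctxInput e).Le Γ π) : Impl Γ (fun g => (π g).n) a b :=
  Impl.reg 0 fun g s hD hR => (h.R g s hD hR).1 0 (by omega)

theorem Impl.l (h : (ctxInput e).Le Γ π) : Impl Γ (fun g => (π g).l) a b :=
  Impl.reg 1 fun g s hD hR => (h.R g s hD hR).1 1 (by omega)

theorem Impl.threshold (h : (ctxInput e).Le Γ π) : Impl Γ (fun g => (π g).k) a b :=
  Impl.reg 2 fun g s hD hR => (h.R g s hD hR).1 2 (by omega)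

theorem Impl.pc (h : (ctxInput e).Le Γ π) (hv : Impl Γ v a b) :
    Impl Γ (fun g => (π g).pc (v g)) a b :=
  Impl.map₁ hv (fun r => .get 1 (.reg r)) _ fun g s r hD hR hr => by
    simp only [Expr.eval, hr, (h.R g s hD hR).2 1 (by omega), Instance.pc]

/-- The index `u * n + v` is formed by repeated addition, which costs one factor `N + 1`. -/
theorem ImplP.adj (h : (ctxInput e).Le Γ π) (hu : Impl Γ u (a + 1) b) (hv : Impl Γ v (a + 1) b)
    (hun : ∀ g, Γ.D g → u g < (π g).n) (hvn : ∀ g, Γ.D g → v g < (π g).n) :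
    ImplP Γ (fun g => (π g).adj (u g) (v g)) (a + 1) b :=
  Impl.map₁ (Impl.add (Impl.mulN hu (Impl.n h)
      fun g hg => (hun g hg).le.trans (h.n_le g hg)) hv) (fun r => .get 0 (.reg r)) _
    fun g s r hD hR hr => by
      simp only [Expr.eval, hr, (h.R g s hD hR).2 0 (by omega)]
      exact (π g).arr_adj (hun g hD) (hvn g hD)

/-- The partner of `v` depends only on the partners of smaller vertices, which are in the part of
the array that is already filled. -/
theorem impl_mate : Impl ((ctxInput e).pushFill (fun I => I.n) fun I => I.mate)
    (fun q => q.1.mate q.2) 2 b := by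
  have h := (ctxInput e).le_pushFill (fun I => I.n) fun I => I.mate
  refine (Impl.lastN (F := fun q u => q.1.mate u = 0 ∧ (∀ w < q.2, q.1.mate w ≠ u + 1) ∧
    ¬q.1.adj u q.2) Impl.varFill (fun j => ?_)
    fun g hg => hg.2.le.trans (h.n_le g hg)).congr fun q _ => (q.1.mate_eq q.2).symm
  have h' := h.push j fun q => q.2
  have hA := Ctx.HasArr.lift (Ctx.le_push _ j fun q => q.2)
    ((ctxInput e).hasArr_pushFill (fun I => I.n) fun I => I.mate)
  refine .and (.eq (.get hA .var fun q hq => hq.2) (.const 0)) (.and ?_ (.not ?_))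
  · exact ImplP.forallN (F := fun q w => q.1.1.mate w ≠ q.2 + 1)
      (Impl.varFill.lift (Ctx.le_push _ _ _))
      (fun j' => ImplP.ne (.get (A := fun q : ((Instance × ℕ) × ℕ) × ℕ => q.1.1.1.mate)
        (hA.lift (Ctx.le_push _ _ _)) .var fun q hq => hq.2)
        (.add (Impl.var.lift (Ctx.le_push _ _ _)) (.const 1)))
      fun g hg => hg.1.2.le.trans (h'.n_le g hg)
  · exact ImplP.adj h' .var (Impl.varFill.lift (Ctx.le_push _ _ _))
      (fun g hg => hg.2.trans hg.1.2) fun g hg => hg.1.2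

theorem impl_mod : Impl ((ctxMate e).pushFill (fun I => I.n) fun I v => ind (I.inMod v))
    (fun q => ind (q.1.inMod q.2)) 1 b := by
  have h : (ctxMate e).Le _ _ := (ctxMate e).le_pushFill (fun I => I.n) fun I v => ind (I.inMod v)
  refine ImplP.or (.ne (h.get .varFill fun g hg => hg.2) (.const 0)) ?_
  refine ImplP.existsN (F := fun q w => q.1.mate w = q.2 + 1) (Impl.n h.of_addArr) (fun j => ?_)
    h.of_addArr.n_le
  exact .eq ((h.push j _).get .var fun g hg => hg.2)
    (.add (Impl.varFill.lift (Ctx.le_push _ _ _)) (.const 1))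

theorem ImplP.inMod (h : (ctxMod e).Le Γ π) (hv : Impl Γ v a b)
    (hvn : ∀ g, Γ.D g → v g < (π g).n) : ImplP Γ (fun g => (π g).inMod (v g)) a b :=
  Ctx.Le.get (Γ := ctxMate e) h hv hvn

theorem ImplP.twin (h : (ctxMod e).Le Γ π) (hu : Impl Γ u 1 b) (hv : Impl Γ v 1 b)
    (hun : ∀ g, Γ.D g → u g < (π g).n) (hvn : ∀ g, Γ.D g → v g < (π g).n) (e' : Bool) :
    ImplP Γ (fun g => (π g).Twin (u g) (v g) e') 2 b := by
  have h₀ : (ctxInput e).Le Γ π := h.of_addArr.of_addArr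
  cases e'
  · refine ImplP.forallN (F := fun g x => (π g).inMod x → ((π g).adj (u g) x ↔ (π g).adj (v g) x))
      (Impl.n h₀) (fun j => ?_) h₀.n_le
    have hp := Γ.le_push j fun g => (π g).n
    exact .imp (.inMod (h.push j _) .var fun g hg => hg.2)
      (.iff (.adj (h₀.push j _) (hu.lift hp) .var (fun g hg => hun _ hg.1) fun g hg => hg.2)
        (.adj (h₀.push j _) (hv.lift hp) .var (fun g hg => hvn _ hg.1) fun g hg => hg.2))
  · have hin : ∀ j, ImplP (Γ.push j fun g => (π g).n) (fun q => (π q.1).inMod q.2) 1 b :=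
      fun j => .inMod (h.push j _) .var fun g hg => hg.2
    exact .lt (.sumN (F := fun g x => ind ((π g).inMod x)) (Impl.n h₀) hin h₀.n_le)
      (.sumN (F := fun g x => ind ((π g).pc x = 0 ∧ ¬(π g).inMod x)) (Impl.n h₀)
        (fun j => ImplP.and (.eq (.pc (h₀.push j _) .var) (.const 0)) (.not (hin j))) h₀.n_le)

theorem impl_root : Impl ((ctxMod e).pushFill (fun I => I.n) fun I => I.root e)
    (fun q => q.1.root e q.2) 3 b := by
  have h : (ctxMod e).Le _ _ := (ctxMod e).le_pushFill (fun I => I.n) fun I => I.root e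
  have h₀ := h.of_addArr.of_addArr
  refine Impl.lastN (F := fun q u => q.1.pc u = 0 ∧ q.1.Eqv e u q.2) (Impl.n h₀)
    (fun j => ?_) h₀.n_le
  have hv : ∀ a b, Impl (Ctx.push _ j fun q : Instance × ℕ => q.1.n) (fun q => q.1.2) a b :=
    fun _ _ => Impl.varFill.lift (Ctx.le_push ((ctxMod e).pushFill (fun I => I.n) fun I => I.root e)
      j _)
  exact .and (.eq (.pc (h₀.push j _) .var) (.const 0)) (.or (.eq .var (hv _ _)) (.and (.and
    (.not (.inMod (h.push j _) .var fun g hg => hg.2))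
    (.not (.inMod (h.push j _) (hv _ _) fun g hg => hg.1.2)))
    (.twin (h.push j _) .var (hv _ _) (fun g hg => hg.2) (fun g hg => hg.1.2) e)))

theorem ImplP.isRep (h : (ctxRoot e).Le Γ π) (hv : Impl Γ v a b)
    (hvn : ∀ g, Γ.D g → v g < (π g).n) : ImplP Γ (fun g => (π g).IsRep e (v g)) a b :=
  .and (.eq (.pc h.of_addArr.of_addArr.of_addArr hv) (.const 0))
    (.eq (Ctx.Le.get (Γ := ctxMod e) h hv hvn) (.add hv (.const 1)))

theorem impl_idx : Impl ((ctxRoot e).pushFill (fun I => I.n) fun I => I.idx e)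
    (fun q => q.1.idx e q.2) 1 b := by
  have h : (ctxRoot e).Le _ _ := (ctxRoot e).le_pushFill (fun I => I.n) fun I => I.idx e
  have h₀ := h.of_addArr.of_addArr.of_addArr
  refine Impl.sumN (F := fun q u => ind (q.1.IsRep e u ∧ u + 1 < q.1.root e q.2)) (Impl.n h₀)
    (fun j => ?_) h₀.n_le
  exact ImplP.and (.isRep (h.push j _) .var fun g hg => hg.2) (.lt (.add .var (.const 1))
    (Ctx.Le.get (Γ := ctxMod e) (h.push j _) (Impl.varFill.lift (Ctx.le_push _ _ _))
      fun g hg => hg.1.2))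

theorem impl_items : Impl ((ctxIdx e).pushFill (fun _ => 1) fun I _ => I.items e)
    (fun q => q.1.items e) 1 b := by
  have h : (ctxIdx e).Le _ _ := (ctxIdx e).le_pushFill (fun _ => 1) fun I _ => I.items e
  have h₀ := h.of_addArr.of_addArr.of_addArr.of_addArr
  exact Impl.sumN (F := fun (q : Instance × ℕ) u => ind (q.1.IsRep e u)) (Impl.n h₀)
    (fun j => ImplP.isRep (h.of_addArr.push j _) .var fun g hg => hg.2) h₀.n_le

theorem Impl.items (h : (ctxItems e).Le Γ π) : Impl Γ (fun g => (π g).items e) a b :=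
  Ctx.Le.get (Γ := ctxIdx e) h (.const 0) fun _ _ => Nat.one_pos

theorem two_pow_eq_rec (n : ℕ) : 2 ^ n = (Nat.rec 1 (fun _ v => v + v) n : ℕ) := by
  induction n with
  | zero => rfl
  | succ n ih => rw [pow_succ, mul_two, ih]

theorem Impl.twoPow (hu : Impl Γ u a (b + 1)) (hle : ∀ g, Γ.D g → u g ≤ Γ.M g + 1) :
    Impl Γ (fun g => 2 ^ u g) a (b + 1) := by
  simp only [two_pow_eq_rec]
  refine Impl.foldM (body := fun _ _ v => v + v) hu (.const 1) (fun j => ?_) hle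
  have hv : Impl (Γ.pushAcc j u) (fun q => q.2) a b := .reg (Γ.k + j) fun _ _ _ h => h.2
  exact .add hv hv

theorem impl_pow : Impl ((ctxItems e).pushFill (fun _ => 1) fun I _ => 2 ^ I.items e)
    (fun q => 2 ^ q.1.items e) a (b + 1) := by
  have h : (ctxItems e).Le _ _ := (ctxItems e).le_pushFill (fun _ => 1) fun I _ => 2 ^ I.items e
  exact .twoPow (.items h) h.of_addArr.of_addArr.of_addArr.of_addArr.of_addArr.items_le

theorem Impl.pow (h : (ctxPow e).Le Γ π) : Impl Γ (fun g => 2 ^ (π g).items e) a b :=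
  Ctx.Le.get (Γ := ctxItems e) h (.const 0) fun _ _ => Nat.one_pos

theorem Impl.rawCol (h : (ctxInput e).Le Γ π) (hv : Impl Γ v a b) :
    Impl Γ (fun g => (π g).rawCol (v g)) a b :=
  .ite (.lt hv (.n h)) (.pc h hv) (.ite (.le (.add hv (.const 1)) (.add (.l h) (.n h)))
    (.sub (.add hv (.const 1)) (.n h)) (.const 0))

theorem impl_col : Impl ((ctxPow e).pushFill (fun I => 2 * I.n) fun I => I.col)
    (fun q => q.1.col q.2) 1 b := by
  have h : (ctxPow e).Le _ _ := (ctxPow e).le_pushFill (fun I => 2 * I.n) fun I => I.col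
  have h₀ := h.of_addArr.of_addArr.of_addArr.of_addArr.of_addArr.of_addArr
  refine .ite (.existsN (F := fun (q : Instance × ℕ) i => q.1.rawCol i = q.1.rawCol q.2) .varFill (fun j => ?_) ?_)
    (.const 0) (.rawCol h₀ .varFill)
  · exact .eq (.rawCol (h₀.push j _) .var)
      (.rawCol (h₀.push j _) (Impl.varFill.lift (Ctx.le_push _ _ _)))
  · exact fun g hg => hg.2.le.trans (Nat.le_succ _)

/-- The machine does not divide; the quotient is the number of positive multiples of `y` up to `x`,
and `z` bounds the search. -/
theorem div_eq_sum {x y z : ℕ} (hy : 0 < y) (hz : x / y ≤ z) :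
    x / y = ∑ i ∈ Finset.range z, ind (y * (i + 1) ≤ x) := by
  rw [sum_ind, ← Finset.card_range (x / y)]
  congr 1
  ext i
  simp only [Finset.mem_filter, Finset.mem_range]
  rw [mul_comm, ← Nat.le_div_iff_mul_le hy]
  omega

/-- The bit is the parity of `q = u / 2 ^ v`, tested as `q = 2 * (q / 2) + 1`. The two divisions
raise the exponent by one each. -/
theorem ImplP.testBit (hu : Impl Γ u a (b + 1)) (hv : Impl Γ v a (b + 1))
    (hule : ∀ g, Γ.D g → u g ≤ Γ.M g + 1) (hvle : ∀ g, Γ.D g → 2 ^ v g ≤ Γ.M g + 1) :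
    ImplP Γ (fun g => (u g).testBit (v g) = true) a (b + 3) := by
  have h1 : Impl Γ (fun g => u g / 2 ^ v g) a (b + 2) := by
    refine Impl.congr (Impl.sumM (F := fun g i => ind (2 ^ v g * (i + 1) ≤ u g))
      (hu.mono le_rfl (by omega)) (fun j => ?_) hule) fun g _ =>
      (div_eq_sum (by positivity) (Nat.div_le_self _ _)).symm
    have hp := Γ.le_push j u
    have h2 : Impl Γ (fun g => 2 ^ v g) a (b + 1) :=
      .twoPow hv fun g hg => Nat.lt_two_pow_self.le.trans (hvle g hg)
    exact ImplP.le (.mulM (h2.lift (f := fun g => 2 ^ v g) hp)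
      (.add .var (.const 1)) fun g hg => hvle _ hg.1) (hu.lift hp)
  have h2 : Impl Γ (fun g => u g / 2 ^ v g / 2) a (b + 3) := by
    refine Impl.congr (Impl.sumM (F := fun g i => ind (2 * (i + 1) ≤ u g / 2 ^ v g))
      (h1.mono le_rfl (by omega)) (fun j => ?_) fun g hg => (Nat.div_le_self _ _).trans (hule g hg))
      fun g _ => (div_eq_sum (by positivity) (Nat.div_le_self _ _)).symm
    refine ImplP.le (.congr (.add (.add .var (.const 1)) (.add .var (.const 1))) fun g _ =>
      (two_mul (g.2 + 1)).symm) (h1.lift (Γ.le_push j _))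
  refine ImplP.congr (.eq (h1.mono le_rfl (by omega)) (.add (.add h2 h2) (.const 1))) fun g _ => ?_
  rw [Nat.testBit_eq_decide_div_mod_eq, decide_eq_true_iff]
  omega

theorem Impl.col (h : (ctxCol e).Le Γ π) (hv : Impl Γ v a b)
    (hvn : ∀ g, Γ.D g → v g < 2 * (π g).n) : Impl Γ (fun g => (π g).col (v g)) a b :=
  Ctx.Le.get (Γ := ctxPow e) h hv hvn

theorem Impl.idx (h : (ctxIdx e).Le Γ π) (hv : Impl Γ v a b)
    (hvn : ∀ g, Γ.D g → v g < (π g).n) : Impl Γ (fun g => (π g).idx e (v g)) a b :=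
  Ctx.Le.get (Γ := ctxRoot e) h hv hvn

theorem Instance.idx_le_items (I : Instance) (e : Bool) (v : ℕ) : I.idx e v ≤ I.items e :=
  Finset.sum_le_sum fun _ _ => ind_mono And.left

/-- Membership in a class of vertices of the same color. -/
theorem ImplP.mem_class (h : (ctxCol e).Le Γ π) {j m : γ → ℕ} (hj : Impl Γ j a (b + 1))
    (hm : Impl Γ m a (b + 1)) (hv : Impl Γ v a (b + 1)) (hjn : ∀ g, Γ.D g → j g < 2 * (π g).n)
    (hmM : ∀ g, Γ.D g → m g < 2 ^ (π g).items e) (hvn : ∀ g, Γ.D g → v g < (π g).n) :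
    ImplP Γ (fun g => (π g).pc (v g) = (π g).col (j g) ∨
      ((π g).pc (v g) = 0 ∧ (m g).testBit ((π g).idx e (v g)) = true)) a (b + 3) := by
  have h₁ := h.of_addArr.of_addArr.of_addArr
  have h₀ := h₁.of_addArr.of_addArr.of_addArr.of_addArr
  have hpc : Impl Γ (fun g => (π g).pc (v g)) a (b + 3) := (Impl.pc h₀ hv).mono le_rfl (by omega)
  refine .or (.eq hpc ((Impl.col h hj hjn).mono le_rfl (by omega)))
    (.and (.eq hpc (.const 0)) (.testBit hm (.idx h₁ hv hvn) ?_ ?_))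
  · exact fun g hg => (hmM g hg).le.trans (h₀.pow_le g hg)
  · exact fun g hg => (Nat.pow_le_pow_right (by omega) ((π g).idx_le_items e _)).trans
      (h₀.pow_le g hg)

/-- Membership in `S` is tested below one loop and below two loops, so `hS` is required for every
refinement of the context. Of the exponent 3, two come from the loops over vertices and one from the
tests inside. -/
theorem Impl.classValue (h : (ctxInput e).Le Γ π) {S : γ → ℕ → Prop}
    (hS : ∀ {γ' : Type} {Γ' : Ctx γ'} {ρ : γ' → γ}, Γ.Le Γ' ρ → ∀ {v : γ' → ℕ}, (∀ a b, Impl Γ' v a b) →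
      (∀ g, Γ'.D g → v g < (π (ρ g)).n) → ImplP Γ' (fun g => S (ρ g) (v g)) 1 b) (e' : Bool) :
    Impl Γ (fun g => (π g).classValue (S g) e') 3 b := by
  cases e'
  · refine Impl.mono (Impl.sumN (a := 2) (F := fun g v => ind (S g v ∧ ∀ u < (π g).n,
      (π g).adj v u → S g u)) (.n h) (fun j => ?_) h.n_le) le_rfl le_rfl
    have h1 := h.push j fun g => (π g).n
    have hp := Γ.le_push j fun g => (π g).n
    refine ImplP.and ((hS hp (fun _ _ => .var) fun g hg => hg.2).mono (by omega) le_rfl)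
      (ImplP.forallN (F := fun (q : γ × ℕ) u => (π q.1).adj q.2 u → S q.1 u) (.n h1) (fun j' => ?_)
        h1.n_le)
    exact ImplP.imp (.adj (h1.push j' _) (Impl.var.lift (Ctx.le_push _ _ _)) .var
      (fun g hg => hg.1.2) fun g hg => hg.2) (hS (hp.push j' _) (fun _ _ => .var) fun g hg => hg.2)
  · refine Impl.sumN (F := fun g v => ∑ u ∈ Finset.range (π g).n,
      ind ((u < v ∧ (π g).adj v u) ∧ S g v ∧ S g u)) (.n h) (fun j => ?_) h.n_le
    have h1 := h.push j fun g => (π g).n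
    have hp := Γ.le_push j fun g => (π g).n
    refine Impl.sumN (F := fun (q : γ × ℕ) u => ind ((u < q.2 ∧ (π q.1).adj q.2 u) ∧
      S q.1 q.2 ∧ S q.1 u)) (.n h1) (fun j' => ?_) h1.n_le
    have hv : ∀ a b, Impl ((Γ.push j fun g => (π g).n).push j' fun q => (π q.1).n) (fun q => q.1.2) a b :=
      fun _ _ => Impl.var.lift (Ctx.le_push _ _ _)
    exact ImplP.and (.and (.lt .var (hv _ _)) (.adj (h1.push j' _) (hv _ _) .var
      (fun g hg => hg.1.2) fun g hg => hg.2)) (.and (hS (hp.push j' _) hv fun g hg => hg.1.2)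
        (hS (hp.push j' _) (fun _ _ => .var) fun g hg => hg.2))

theorem Ctx.Le.comp {γ' : Type} {Γ' : Ctx γ'} {Γ₀ : Ctx Instance}
    {ρ : γ' → γ} {τ : γ → Instance} (h : Γ₀.Le Γ τ) (h' : Γ.Le Γ' ρ) :
    Γ₀.Le Γ' (fun g => τ (ρ g)) where
  D g hg := h.D _ (h'.D g hg)
  R g s hD hR := h.R _ s (h'.D g hD) (h'.R g s hD hR)
  k := h.k.trans h'.k
  N g := (h'.N g).trans (h.N _)
  M g := (h'.M g).trans (h.M _)

theorem Impl.layer (h : (ctxCol e).Le Γ π) {j m : γ → ℕ} (hj : Impl Γ j 1 (b + 1))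
    (hm : Impl Γ m 1 (b + 1)) (hjn : ∀ g, Γ.D g → j g < 2 * (π g).n)
    (hmM : ∀ g, Γ.D g → m g < 2 ^ (π g).items e) :
    Impl Γ (fun g => (π g).layer e (j g) (m g)) 3 (b + 3) := by
  have h₀ := h.of_addArr.of_addArr.of_addArr.of_addArr.of_addArr.of_addArr.of_addArr
  refine .ite (.eq (.mono (.col h hj hjn) (by omega) (by omega)) (.const 0)) (.const 0)
    (.classValue h₀ (S := fun g v => (π g).pc v = (π g).col (j g) ∨
      ((π g).pc v = 0 ∧ (m g).testBit ((π g).idx e v) = true)) ?_ e)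
  intro γ' Γ' ρ hρ v hv hvn
  exact .mem_class (h.comp hρ) (hj.lift hρ) (hm.lift hρ) (hv _ _) (fun g hg => hjn _ (hρ.D g hg))
    (fun g hg => hmM _ (hρ.D g hg)) hvn

theorem ImplP.split (h : (ctxItems e).Le Γ π) {m m₁ m₂ : γ → ℕ} (hm : Impl Γ m a (b + 1))
    (hm₁ : Impl Γ m₁ a (b + 1)) (hm₂ : Impl Γ m₂ a (b + 1))
    (hmM : ∀ g, Γ.D g → m g < 2 ^ (π g).items e) (hmM₁ : ∀ g, Γ.D g → m₁ g < 2 ^ (π g).items e)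
    (hmM₂ : ∀ g, Γ.D g → m₂ g < 2 ^ (π g).items e) :
    ImplP Γ (fun g => (π g).Split e (m g) (m₁ g) (m₂ g)) a (b + 4) := by
  have h₀ := h.of_addArr.of_addArr.of_addArr.of_addArr.of_addArr
  refine ImplP.forallM (F := fun g i => ((m₁ g).testBit i = true →
    (m g).testBit i = true ∧ ¬(m₂ g).testBit i = true) ∧
    ((m₂ g).testBit i = true → (m g).testBit i = true)) (.items h) (fun j => ?_) h₀.items_le
  have key : ∀ {x : γ → ℕ}, Impl Γ x a (b + 1) → (∀ g, Γ.D g → x g < 2 ^ (π g).items e) →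
      ImplP (Γ.push j fun g => (π g).items e) (fun q => (x q.1).testBit q.2 = true) a (b + 3) := by
    intro x hx hxM
    refine .testBit (hx.lift (Γ.le_push j _)) .var ?_ ?_
    · exact fun g hg => (hxM _ hg.1).le.trans (h₀.pow_le _ hg.1)
    · exact fun g hg => (Nat.pow_le_pow_right (by omega) hg.2.le).trans (h₀.pow_le _ hg.1)
  exact .and (.imp (key hm₁ hmM₁) (.and (key hm hmM) (.not (key hm₂ hmM₂))))
    (.imp (key hm₂ hmM₂) (key hm hmM))

-- The recurrence in terms of the position `i = j * 2 ^ t + m` in the table, where `t` is the number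
-- of groups. The first `2 ^ t` positions form row `0`.
open Classical in
theorem Instance.opt_eq (I : Instance) (e : Bool) (i : ℕ) :
    I.opt e (i / 2 ^ I.items e) (i % 2 ^ I.items e) =
      if i < 2 ^ I.items e then 0 else (Finset.range (2 ^ I.items e)).sup fun m₁ =>
        (Finset.range (2 ^ I.items e)).sup fun m₂ =>
          if I.Split e (i % 2 ^ I.items e) m₁ m₂ then
            I.opt e (i / 2 ^ I.items e - 1) m₁ + I.layer e (i / 2 ^ I.items e - 1) m₂ else 0 := by
  split_ifs with h
  · rw [Nat.div_eq_of_lt h, opt]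
  · obtain ⟨j, hj⟩ := Nat.exists_eq_add_of_lt (Nat.div_pos (not_lt.1 h) (by positivity))
    rw [hj, zero_add, opt, Nat.add_sub_cancel]

/-- Row `j` needs only row `j - 1`, which precedes it in the table. Of the exponent 7 of the scale
`M`, two come from the maxima over `m₁` and `m₂`, and five from the test of `Split`. -/
theorem impl_opt : Impl ((ctxCol e).pushFill (fun I => (2 * I.n + 1) * 2 ^ I.items e)
    fun I i => I.opt e (i / 2 ^ I.items e) (i % 2 ^ I.items e))
    (fun q => q.1.opt e (q.2 / 2 ^ q.1.items e) (q.2 % 2 ^ q.1.items e)) 3 7 := by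
  classical
  set Γ := (ctxCol e).pushFill (fun I => (2 * I.n + 1) * 2 ^ I.items e)
    fun I i => I.opt e (i / 2 ^ I.items e) (i % 2 ^ I.items e) with hΓ
  have h : (ctxCol e).Le Γ Prod.fst := Ctx.le_pushFill _ _ _
  have hT : Γ.HasArr (ctxCol e).na (fun q => q.2)
    (fun q i => q.1.opt e (i / 2 ^ q.1.items e) (i % 2 ^ q.1.items e)) := Ctx.hasArr_pushFill _ _ _
  have h₀ := h.of_addArr.of_addArr.of_addArr.of_addArr.of_addArr.of_addArr.of_addArr
  have hi : ∀ a b, Impl Γ (fun q => q.2) a b := fun a b => Impl.varFill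
  have hM : ∀ a b, Impl Γ (fun q => 2 ^ q.1.items e) a b := fun a b => .pow h.of_addArr
  have hjn : ∀ q, Γ.D q → q.2 / 2 ^ q.1.items e < 2 * q.1.n + 1 := fun q hq =>
    Nat.div_lt_of_lt_mul (hq.2.trans_eq (mul_comm _ _))
  have hj : Impl Γ (fun q => q.2 / 2 ^ q.1.items e) 1 1 := by
    -- The row number is at most `2 * n`, so the search for the quotient is charged to the scale
    -- `N`, not to `M`.
    refine Impl.congr (Impl.sumN (F := fun (q : Instance × ℕ) x =>
      ind (2 ^ q.1.items e * (x + 1) ≤ q.2)) (c := fun q : Instance × ℕ => q.1.n + q.1.n + 1)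
      (.add (.add (.n h₀) (.n h₀)) (.const 1)) (fun j => ?_) fun q hq => ?_)
      fun q hq => (div_eq_sum (by positivity) (by have := hjn q hq; omega)).symm
    · have hp := Γ.le_push j fun q => q.1.n + q.1.n + 1
      exact ImplP.le (.mulM ((hM _ _).lift (f := fun q => 2 ^ q.1.items e) hp) (.add .var (.const 1))
        fun q hq => h₀.pow_le _ hq.1) ((hi _ _).lift hp)
    · have : Γ.N q = 2 * q.1.n := h₀.N q
      omega
  have hjM : Impl Γ (fun q => 2 ^ q.1.items e * (q.2 / 2 ^ q.1.items e)) 1 2 :=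
    .mulM (hM _ _) hj fun q hq => h₀.pow_le _ hq
  have hr : Impl Γ (fun q => q.2 % 2 ^ q.1.items e) 1 2 :=
    Impl.congr (.sub (hi _ _) hjM) fun q _ => by
      have := Nat.div_add_mod q.2 (2 ^ q.1.items e)
      omega
  refine Impl.congr ?_ fun q _ => (q.1.opt_eq e q.2).symm
  -- The assumption in the second branch says that the row number is at least `1`; otherwise the
  -- previous row would not exist.
  refine .ite_assume (.lt (hi _ _) (hM _ _)) (.const 0) ?_
  set Γ₁ := Γ.assume fun q => ¬q.2 < 2 ^ q.1.items e
  have ha : Γ.Le Γ₁ id := Γ.le_assume _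
  have h₁ := h₀.comp ha
  refine .supM (c := fun q => 2 ^ q.1.items e) (F := fun (q : Instance × ℕ) m₁ =>
    (Finset.range (2 ^ q.1.items e)).sup fun m₂ =>
      if q.1.Split e (q.2 % 2 ^ q.1.items e) m₁ m₂ then
        q.1.opt e (q.2 / 2 ^ q.1.items e - 1) m₁ + q.1.layer e (q.2 / 2 ^ q.1.items e - 1) m₂ else 0)
    (.lift (f := fun q => 2 ^ q.1.items e) ha (hM _ _)) (fun j₁ => ?_) h₁.pow_le
  have ha₁ := ha.push j₁ fun q => 2 ^ q.1.items e
  have h₂ := h₁.push j₁ fun q => 2 ^ q.1.items e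
  refine .supM (c := fun q : (Instance × ℕ) × ℕ => 2 ^ q.1.1.items e)
    (F := fun (q : (Instance × ℕ) × ℕ) m₂ =>
      if q.1.1.Split e (q.1.2 % 2 ^ q.1.1.items e) q.2 m₂ then
        q.1.1.opt e (q.1.2 / 2 ^ q.1.1.items e - 1) q.2 +
          q.1.1.layer e (q.1.2 / 2 ^ q.1.1.items e - 1) m₂ else 0)
    (.lift (f := fun q => 2 ^ q.1.items e) ha₁ (hM _ _)) (fun j₂ => ?_) h₂.pow_le
  have ha₂ := ha₁.push j₂ fun q : (Instance × ℕ) × ℕ => 2 ^ q.1.1.items e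
  set Γ₂ := (Γ₁.push j₁ fun q => 2 ^ q.1.items e).push j₂ fun q => 2 ^ q.1.1.items e
  have hm₁ : ∀ a b, Impl Γ₂ (fun q => q.1.2) a b := fun a b => Impl.var.lift (Ctx.le_push _ _ _)
  have hD : ∀ q, Γ₂.D q → 1 ≤ q.1.1.2 / 2 ^ q.1.1.1.items e := fun q hq =>
    Nat.div_pos (not_lt.1 hq.1.1.2) (by positivity)
  have hj₂ : Impl Γ₂ (fun q => q.1.1.2 / 2 ^ q.1.1.1.items e - 1) 1 1 :=
    .sub (hj.lift ha₂) (.const 1)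
  -- The position of the mask `m₁` in the previous row.
  have hx : Impl Γ₂ (fun q => 2 ^ q.1.1.1.items e * (q.1.1.2 / 2 ^ q.1.1.1.items e) -
      2 ^ q.1.1.1.items e + q.1.2) 3 5 :=
    Impl.add (.sub (.mono (hjM.lift ha₂) (by omega) (by omega))
      (.lift (f := fun q => 2 ^ q.1.items e) ha₂ (hM _ _))) (hm₁ _ _)
  refine .ite (ImplP.mono (.split (h.comp ha₂).of_addArr.of_addArr (b := 1) (hr.lift ha₂) (hm₁ _ _) .var
      (fun q _ => Nat.mod_lt _ (by positivity)) (fun q hq => hq.1.2) fun q hq => hq.2)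
      (by omega) (by omega)) (.add ?_ (.mono (.layer (h.comp ha₂) (b := 0) hj₂ .var (fun q hq => ?_)
        fun q hq => hq.2) le_rfl (by omega))) (.const 0)
  · refine Impl.congr (.get (A := fun q i => q.1.1.1.opt e (i / 2 ^ q.1.1.1.items e)
      (i % 2 ^ q.1.1.1.items e)) (hT.lift ha₂) hx ?_) ?_
    · intro q hq
      have h1 : q.1.2 < 2 ^ q.1.1.1.items e := hq.1.2
      have h2 := Nat.mul_div_le q.1.1.2 (2 ^ q.1.1.1.items e)
      have h3 := Nat.mul_le_mul_left (2 ^ q.1.1.1.items e) (hD q hq)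
      simp only [id_eq]
      omega
    · intro q hq
      have h1 : q.1.2 < 2 ^ q.1.1.1.items e := hq.1.2
      have h2 : 2 ^ q.1.1.1.items e * (q.1.1.2 / 2 ^ q.1.1.1.items e) - 2 ^ q.1.1.1.items e =
          2 ^ q.1.1.1.items e * (q.1.1.2 / 2 ^ q.1.1.1.items e - 1) := by
        rw [Nat.mul_sub, mul_one]
      simp only [h2, Nat.mul_add_mod, Nat.mod_eq_of_lt h1, Nat.mul_add_div (Nat.two_pow_pos _),
        Nat.div_eq_of_lt h1, add_zero]
  · have h1 := hD q hq
    have h2 := hjn q.1.1 hq.1.1.1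
    simp only [id_eq]
    omega

/-- One program decides the problem in time `O ((2 * n + 1) ^ 4 * (2 ^ t + 1) ^ 8)` where `t` is the
number of groups. -/
theorem exists_program (e : Bool) : ∃ (P : Program) (C : ℕ), ∀ I : Instance, ∃ s t,
    Exec P I.toState s t ∧ t ≤ C * ((2 * I.n + 1) ^ 4 * (2 ^ I.items e + 1) ^ 8) ∧
      (s.reg 0 = 1 ↔ problem e I) := by
  have hn : ∀ I : Instance, I.n ≤ (ctxInput e).cost 1 1 I := fun I =>
    (Nat.le_mul_of_pos_right I.n (Nat.succ_pos (2 ^ I.items e))).trans (by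
      simp only [Ctx.cost, ctxInput, inputCtx, pow_one]
      exact Nat.mul_le_mul_right _ (by omega))
  have hN : ∀ I : Instance, 2 * I.n ≤ (ctxInput e).cost 1 1 I := fun I =>
    (Nat.le_mul_of_pos_right (2 * I.n) (Nat.succ_pos (2 ^ I.items e))).trans (by
      simp only [Ctx.cost, ctxInput, inputCtx, pow_one]
      exact Nat.mul_le_mul_right _ (by omega))
  -- All phases are charged like the most expensive one, the table of `opt`: exponents 3 and 7 for
  -- one entry, and one more of each for the length of the table.
  have h0 : Reach (ctxInput e) (3 + 1) (7 + 1) := Reach.input _ _ _ _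
  have h1 : Reach (ctxMate e) (3 + 1) (7 + 1) := h0.fill (.n (Ctx.le_refl _))
    (impl_mate.mono (by omega) le_rfl) hn
  have h2 : Reach (ctxMod e) (3 + 1) (7 + 1) := h1.fill (.n (Ctx.le_addArr _ _ _))
    (impl_mod.mono (by omega) le_rfl) hn
  have h3 : Reach (ctxRoot e) (3 + 1) (7 + 1) := h2.fill
    (.n (Ctx.le_refl (ctxMod e)).of_addArr.of_addArr) impl_root hn
  have h4 : Reach (ctxIdx e) (3 + 1) (7 + 1) := h3.fill
    (.n (Ctx.le_refl (ctxRoot e)).of_addArr.of_addArr.of_addArr) (impl_idx.mono (by omega) le_rfl) hn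
  have h5 : Reach (ctxItems e) (3 + 1) (7 + 1) := h4.fill (.const 1)
    (impl_items.mono (by omega) le_rfl) (Ctx.one_le_cost _ 1 1)
  have h6 : Reach (ctxPow e) (3 + 1) (7 + 1) := h5.fill (.const 1) impl_pow (Ctx.one_le_cost _ 1 1)
  have hc {Γ : Ctx Instance} (h : (ctxInput e).Le Γ id) (a b : ℕ) :
      Impl Γ (fun I => 2 * I.n) a b :=
    Impl.congr (.add (.n h) (.n h)) fun I _ => (two_mul I.n).symm
  have h7 : Reach (ctxCol e) (3 + 1) (7 + 1) := h6.fill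
    (hc (Ctx.le_refl (ctxPow e)).of_addArr.of_addArr.of_addArr.of_addArr.of_addArr.of_addArr _ _)
    (impl_col.mono (by omega) le_rfl) hN
  have hl7 := (Ctx.le_refl (ctxCol e)).of_addArr.of_addArr.of_addArr.of_addArr.of_addArr.of_addArr
  have h8 : Reach (ctxOpt e) (3 + 1) (7 + 1) := h7.fill
    (.mulN (.add (hc hl7.of_addArr _ _) (.const 1)) (.pow (Ctx.le_refl (ctxCol e)).of_addArr) fun I _ => le_rfl) impl_opt
    (fun I => by
      simp only [Ctx.cost, ctxCol, ctxPow, ctxItems, ctxIdx, ctxRoot, ctxMod, ctxMate, ctxInput,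
        Ctx.addArr, inputCtx, pow_one]
      exact Nat.mul_le_mul_left _ (Nat.le_succ _))
  have hl8 : (ctxCol e).Le (ctxOpt e) id := Ctx.le_addArr _ _ _
  have hl0 := hl8.of_addArr.of_addArr.of_addArr.of_addArr.of_addArr.of_addArr.of_addArr
  have hp : ImplP (ctxOpt e) (fun I => 0 < I.l ∧ ∃ m < 2 ^ I.items e, I.k ≤ I.opt e (2 * I.n) m)
      (3 + 1) (7 + 1) := by
    refine .and (.lt (.const 0) (.l hl0)) (.existsM (c := fun I : Instance => 2 ^ I.items e)
      (F := fun (I : Instance) m => I.k ≤ I.opt e (2 * I.n) m)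
      (.pow hl8.of_addArr) (fun j => ?_) hl0.pow_le)
    have hl8' := (ctxOpt e).le_push j fun I => 2 ^ I.items e
    have hl0' := hl0.push j fun I => 2 ^ I.items e
    refine .le (.threshold hl0') (Impl.congr (Ctx.Le.get (Γ := ctxCol e) hl8' (f := fun q =>
      2 ^ q.1.items e * (2 * q.1.n) + q.2) (.add (.mulM (.pow (hl8.push j _).of_addArr)
        (Impl.lift (f := fun I : Instance => 2 * I.n) ((ctxOpt e).le_push j _) (hc hl0 _ _)) hl0'.pow_le) .var) ?_) ?_)
    · intro q hq
      have h1 : q.2 < 2 ^ q.1.items e := hq.2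
      simp only [add_mul, one_mul]
      rw [mul_comm]
      omega
    · intro q hq
      have h1 : q.2 < 2 ^ q.1.items e := hq.2
      simp only [Nat.mul_add_mod, Nat.mod_eq_of_lt h1, Nat.mul_add_div (Nat.two_pow_pos _),
        Nat.div_eq_of_lt h1, add_zero]
  obtain ⟨P, C, hP⟩ := h8.decide hp
  refine ⟨P, C, fun I => ?_⟩
  obtain ⟨s, t, h1, h2, h3⟩ := hP I
  exact ⟨s, t, h1, h2, h3.trans (I.problem_iff_opt e).symm⟩

end
end HappyColoring

namespace HappyColoring
open Instance

/-! ### Running times -/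

/-- For `d ≥ B` this is monotonicity in the base, and the finitely many smaller `d` are absorbed by
`B ^ B`. The convention `0 ^ 0 = 1` enters at `d = 0`. -/
theorem exists_pow_le (B : ℕ) : ∃ K : ℕ, ∀ d : ℕ, B ^ d ≤ K * d ^ d := by
  refine ⟨B ^ B + 1, fun d => ?_⟩
  have hd : 1 ≤ d ^ d := by
    rcases Nat.eq_zero_or_pos d with rfl | h
    · simp
    · exact Nat.one_le_pow _ _ h
  rcases le_total B d with h | h
  · exact (Nat.pow_le_pow_left h d).trans (Nat.le_mul_of_pos_left _ (Nat.succ_pos _))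
  · refine le_trans ?_ (Nat.le_mul_of_pos_right _ hd)
    rcases Nat.eq_zero_or_pos B with rfl | hB
    · obtain rfl : d = 0 := by omega
      simp
    · exact (Nat.pow_le_pow_right hB h).trans (Nat.le_succ _)

variable (I : Instance)

/-- A graph with a small clique modulator has many edges. -/
theorem Instance.sq_le_m {X : Finset (Fin I.n)} (hX : IsCliqueModulator I.G X)
    (h : 2 * X.card + 2 ≤ I.n) : I.n ^ 2 ≤ 8 * I.m := by
  classical
  have hm : I.m = I.G.edgeFinset.card := by
    rw [Instance.m, Set.ncard_eq_toFinset_card']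
    rfl
  have hdeg : ∀ v ∈ Xᶜ, I.n - X.card - 1 ≤ I.G.degree v := by
    intro v hv
    have hc : (Xᶜ.erase v).card = I.n - X.card - 1 := by
      rw [Finset.card_erase_of_mem hv, Finset.card_compl, Fintype.card_fin]
    rw [← hc, ← SimpleGraph.card_neighborFinset_eq_degree]
    refine Finset.card_le_card fun u hu => ?_
    rw [Finset.mem_erase, Finset.mem_compl] at hu
    rw [SimpleGraph.mem_neighborFinset]
    exact hX (Finset.mem_compl.1 hv) hu.2 (Ne.symm hu.1)
  have hsum : (I.n - X.card) * (I.n - X.card - 1) ≤ 2 * I.m := by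
    rw [hm, ← SimpleGraph.sum_degrees_eq_twice_card_edges]
    calc (I.n - X.card) * (I.n - X.card - 1) = ∑ v ∈ Xᶜ, (I.n - X.card - 1) := by
          rw [Finset.sum_const, Finset.card_compl, Fintype.card_fin, smul_eq_mul]
      _ ≤ ∑ v ∈ Xᶜ, I.G.degree v := Finset.sum_le_sum hdeg
      _ ≤ ∑ v, I.G.degree v :=
          Finset.sum_le_sum_of_subset (Finset.subset_univ _)
  -- Both factors are at least `n / 2`, so `n ^ 2 / 4 ≤ 2 * m`. The slack `y` removes the truncated
  -- subtractions.
  obtain ⟨y, hy⟩ := Nat.exists_eq_add_of_le h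
  have h1 : I.n - X.card = X.card + 2 + y := by omega
  rw [h1] at hsum
  have h2 : X.card + 2 + y - 1 = X.card + 1 + y := by omega
  rw [h2] at hsum
  rw [hy]
  nlinarith

theorem two_mul_add_one_le (d : ℕ) : 2 * d + 1 ≤ 3 ^ d := by
  induction d with
  | zero => simp
  | succ d ih => rw [pow_succ]; omega

/-- With `d` the size of `X`: if `2 * d + 2 ≤ n`, then `n ^ 4 ≤ 64 * m ^ 2`, and `m ^ 2` is below
the product since `1 ≤ √n`. Otherwise `n ≤ 2 * d + 1 ≤ 3 ^ d`, so two of the factors `n` are paid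
for by `9 ^ d` and the other two by the summands `n` in the product. -/
theorem Instance.pow_four_le {X : Finset (Fin I.n)} (hX : IsCliqueModulator I.G X)
    (hn : 0 < I.n) : (I.n : ℝ) ^ 4 ≤ 64 * 9 ^ X.card *
      (((I.n : ℝ) + √(I.n : ℝ) * (I.m : ℝ)) * ((I.n : ℝ) + (I.m : ℝ))) := by
  have hn' : (1 : ℝ) ≤ I.n := by exact_mod_cast hn
  have hs : 1 ≤ √(I.n : ℝ) := Real.one_le_sqrt.2 hn'
  have hm : (0 : ℝ) ≤ I.m := Nat.cast_nonneg _
  have hsm : (I.m : ℝ) ≤ √(I.n : ℝ) * I.m := le_mul_of_one_le_left hm hs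
  have h9 : (1 : ℝ) ≤ 9 ^ X.card := one_le_pow₀ (by norm_num)
  by_cases h : 2 * X.card + 2 ≤ I.n
  · have h1 : (I.n : ℝ) ^ 2 ≤ 8 * I.m := by exact_mod_cast I.sq_le_m hX h
    calc (I.n : ℝ) ^ 4 = (I.n : ℝ) ^ 2 * (I.n : ℝ) ^ 2 := by ring
      _ ≤ (8 * (I.m : ℝ)) * (8 * (I.m : ℝ)) := by gcongr
      _ = 64 * 1 * ((0 + (I.m : ℝ)) * (0 + (I.m : ℝ))) := by ring
      _ ≤ _ := by gcongr <;> positivity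
  · have h1 : I.n ≤ 3 ^ X.card := (by omega : I.n ≤ 2 * X.card + 1).trans (two_mul_add_one_le _)
    have h2 : (I.n : ℝ) ≤ 3 ^ X.card := by exact_mod_cast h1
    calc (I.n : ℝ) ^ 4 = (I.n : ℝ) ^ 2 * (((I.n : ℝ) + 0) * ((I.n : ℝ) + 0)) := by ring
      _ ≤ (3 ^ X.card) ^ 2 * (((I.n : ℝ) + √(I.n : ℝ) * (I.m : ℝ)) * ((I.n : ℝ) + (I.m : ℝ))) := by
          gcongr
          positivity
      _ = 1 * 9 ^ X.card * (((I.n : ℝ) + √(I.n : ℝ) * (I.m : ℝ)) * ((I.n : ℝ) + (I.m : ℝ))) := by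
          rw [← pow_mul, mul_comm X.card 2, pow_mul]
          norm_num
      _ ≤ _ := by
          gcongr
          norm_num

/-- The running time for edges in terms of a clique modulator. -/
theorem exists_program_edges : ∃ (P : Program) (K : ℝ), ∀ I : Instance, 0 < I.n → 0 < I.l →
    ∀ X : Finset (Fin I.n), IsCliqueModulator I.G X →
      DecidesWithin P MaxHappyEdges I (K * ((I.l : ℝ) * (X.card : ℝ) ^ X.card *
        ((I.n : ℝ) + √(I.n : ℝ) * (I.m : ℝ)) * ((I.n : ℝ) + (I.m : ℝ)))) := by
  obtain ⟨P, C, hP⟩ := exists_program true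
  -- The factor `9 ^ d` comes from `Instance.pow_four_le` and `(2 ^ 32) ^ d` from the eighth power
  -- of `2 ^ (4 * d + 2)`, which leaves the constant `2 ^ 16`. The constant 81 comes from `(3 * n) ^
  -- 4`, and the factor `l` from `1 ≤ l`.
  obtain ⟨K, hK⟩ := exists_pow_le (9 * 2 ^ 32)
  refine ⟨P, C * (81 * 2 ^ 16 * 64 * K), fun I hn hl X hX => ?_⟩
  obtain ⟨s, t, h1, h2, h3⟩ := hP I
  refine ⟨s, t, h1, ?_, h3⟩
  have hl' : (1 : ℝ) ≤ I.l := by exact_mod_cast hl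
  set Q : ℝ := ((I.n : ℝ) + √(I.n : ℝ) * (I.m : ℝ)) * ((I.n : ℝ) + (I.m : ℝ)) with hQ
  have hQ0 : 0 ≤ Q := by positivity
  have ht : (2 ^ I.items true + 1) ^ 8 ≤ 2 ^ 16 * (2 ^ 32) ^ X.card := by
    have h4 : I.items true ≤ 4 * X.card + 1 := by
      have := I.items_true_le
      have := I.card_modulator_le hX
      omega
    have h5 : 2 ^ I.items true + 1 ≤ 2 ^ (4 * X.card + 2) := by
      have h6 := Nat.pow_le_pow_right (n := 2) (by omega) h4
      have h7 := Nat.one_le_two_pow (n := 4 * X.card + 1)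
      rw [pow_succ 2 (4 * X.card + 1)]
      omega
    refine (Nat.pow_le_pow_left h5 8).trans_eq ?_
    rw [← pow_mul, ← pow_mul, ← pow_add]
    congr 1
    ring
  have hnn : (2 * I.n + 1) ^ 4 ≤ 81 * I.n ^ 4 := by
    refine (Nat.pow_le_pow_left (by omega : 2 * I.n + 1 ≤ 3 * I.n) 4).trans_eq ?_
    ring
  have hK' : (9 : ℝ) ^ X.card * (2 ^ 32) ^ X.card ≤ K * (X.card : ℝ) ^ X.card := by
    rw [← mul_pow]
    exact_mod_cast hK X.card
  have h4 : t ≤ C * (81 * I.n ^ 4 * (2 ^ 16 * (2 ^ 32) ^ X.card)) :=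
    h2.trans (Nat.mul_le_mul_left _ (Nat.mul_le_mul hnn ht))
  calc (t : ℝ) ≤ C * (81 * (I.n : ℝ) ^ 4 * (2 ^ 16 * (2 ^ 32) ^ X.card)) := by exact_mod_cast h4
    _ ≤ C * (81 * (64 * 9 ^ X.card * Q) * (2 ^ 16 * (2 ^ 32) ^ X.card)) := by
        gcongr
        exact I.pow_four_le hX hn
    _ = C * (81 * 2 ^ 16 * 64) * Q * (9 ^ X.card * (2 ^ 32) ^ X.card) := by ring
    _ ≤ C * (81 * 2 ^ 16 * 64) * Q * (K * (X.card : ℝ) ^ X.card) := by gcongr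
    _ = C * (81 * 2 ^ 16 * 64 * K) * (1 * (X.card : ℝ) ^ X.card * Q) := by ring
    _ ≤ C * (81 * 2 ^ 16 * 64 * K) * (I.l * (X.card : ℝ) ^ X.card * Q) := by gcongr
    _ = _ := by rw [hQ]; ring

/-! ### Fixed-parameter tractability -/

theorem primrec_two_pow : Primrec fun n : ℕ => 2 ^ n := by
  refine (Primrec.nat_rec₁ 1 (Primrec.nat_add.comp Primrec.snd Primrec.snd).to₂).of_eq fun n => ?_
  induction n with
  | zero => rfl
  | succ n ih => rw [pow_succ, mul_two, ← ih]

/-- The part of the running time that depends on the distance to clique. -/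
def parameterCost (C d : ℕ) : ℕ := C * (81 * 2 ^ (8 * (4 * d + 2 + 2 ^ (2 * d))))

theorem computable_parameterCost (C : ℕ) : Computable (parameterCost C) := by
  have hmul : ∀ (a : ℕ) {f : ℕ → ℕ}, Primrec f → Primrec fun d => a * f d := fun a f hf =>
    Primrec.nat_mul.comp (Primrec.const a) hf
  have hadd : ∀ {f g : ℕ → ℕ}, Primrec f → Primrec g → Primrec fun d => f d + g d := fun hf hg =>
    Primrec.nat_add.comp hf hg
  exact (hmul C (hmul 81 (primrec_two_pow.comp (hmul 8 (hadd (hadd (hmul 4 Primrec.id)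
    (Primrec.const 2)) (primrec_two_pow.comp (hmul 2 Primrec.id))))))).to_comp

theorem isFPT_problem (e : Bool) : IsFPT (problem e) distToClique := by
  obtain ⟨P, C, hP⟩ := exists_program e
  refine ⟨P, parameterCost C, 4, computable_parameterCost C, fun I => ?_⟩
  obtain ⟨s, t, h1, h2, h3⟩ := hP I
  refine ⟨s, t, h1, Nat.cast_le.2 (h2.trans ?_), h3⟩
  obtain ⟨X, hX, hXc⟩ : ∃ X : Finset (Fin I.n), IsCliqueModulator I.G X ∧
      X.card = distToClique I :=
    Nat.sInf_mem (s := {d | ∃ X : Finset (Fin I.n), IsCliqueModulator I.G X ∧ X.card = d})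
      ⟨_, Finset.univ, by simp [IsCliqueModulator], rfl⟩
  have hm := I.card_modulator_le hX
  rw [hXc] at hm
  set d := distToClique I
  -- One bound for both problems: the computed modulator has at most `2 * d` vertices, which gives
  -- at most `2 * d + 2 ^ (2 * d)` groups for vertices and `4 * d + 1` for edges.
  have ht : I.items e ≤ 4 * d + 1 + 2 ^ (2 * d) := by
    cases e
    · have h4 := I.items_false_le
      have h5 := Nat.pow_le_pow_right (n := 2) (by omega) hm
      omega
    · have h4 := I.items_true_le
      have h5 := Nat.one_le_two_pow (n := 2 * d)
      omega
  have h5 : (2 ^ I.items e + 1) ^ 8 ≤ 2 ^ (8 * (4 * d + 2 + 2 ^ (2 * d))) := by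
    have h6 : 2 ^ I.items e + 1 ≤ 2 ^ (I.items e + 1) := by
      have := Nat.one_le_two_pow (n := I.items e)
      rw [pow_succ]
      omega
    refine (Nat.pow_le_pow_left h6 8).trans ?_
    rw [← pow_mul]
    exact Nat.pow_le_pow_right (by omega) (by omega)
  -- Since `k` is positive, its binary length contributes at least one bit, which covers the case `n
  -- = 0`.
  have hsize : 2 * I.n + 1 ≤ 3 * I.size := by
    have h6 : I.n ≤ I.n ^ 2 := Nat.le_self_pow (by omega) _
    have h7 : 0 < Nat.size I.k := Nat.size_pos.2 I.k_pos
    simp only [Instance.size]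
    omega
  calc C * ((2 * I.n + 1) ^ 4 * (2 ^ I.items e + 1) ^ 8)
      ≤ C * ((3 * I.size) ^ 4 * 2 ^ (8 * (4 * d + 2 + 2 ^ (2 * d)))) :=
        Nat.mul_le_mul_left _ (Nat.mul_le_mul (Nat.pow_le_pow_left hsize 4) h5)
    _ = parameterCost C d * I.size ^ 4 := by
        rw [parameterCost]
        ring

end HappyColoring

/-! ### The main theorem -/

theorem mainTheorem3 :
    HappyColoring.IsFPT HappyColoring.MaxHappyVertices HappyColoring.distToClique ∧
    HappyColoring.IsFPT HappyColoring.MaxHappyEdges HappyColoring.distToClique ∧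
    (∃ (P : HappyColoring.Program) (K : ℝ),
      ∀ I : HappyColoring.Instance, 0 < I.n → 0 < I.l →
        ∀ X : Finset (Fin I.n), HappyColoring.IsCliqueModulator I.G X →
          HappyColoring.DecidesWithin P HappyColoring.MaxHappyEdges I
            (K * ((I.l : ℝ) * (X.card : ℝ) ^ X.card *
              ((I.n : ℝ) + √(I.n : ℝ) * (I.m : ℝ)) * ((I.n : ℝ) + (I.m : ℝ))))) ∧
    (∀ (I : HappyColoring.Instance) (X : Finset (Fin I.n)),
      HappyColoring.IsCliqueModulator I.G X →
      X.card + 1 < {v : Fin I.n | v ∉ X ∧ I.p v = none}.ncard →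
      ∀ c : Fin I.n → Fin I.l, HappyColoring.IsOptimalForEdges I.G I.p c →
        ∃ a : Fin I.l, ∀ v : Fin I.n, v ∉ X → I.p v = none → c v = a) := by
  refine ⟨HappyColoring.isFPT_problem false, HappyColoring.isFPT_problem true,
    HappyColoring.exists_program_edges, fun I X hX hlt c hc => ?_⟩
  obtain ⟨w, hw⟩ : {v : Fin I.n | v ∉ X ∧ I.p v = none}.Nonempty :=
    Set.nonempty_of_ncard_ne_zero (by omega)
  exact ⟨c w, fun v hv hp => hc.eq_of_card_lt hX (by omega) ⟨hv, hp⟩ hw⟩
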